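/- Let $\mathcal G$ be a hereditary class of finite undirected graphs (closed under induced subgraphs) of bounded expansion, i.e. for every integer $r\ge 0$ the quantity $\nabla_r(\mathcal G)=\sup_H |E(H)|/|V(H)|$ is finite, where $H$ ranges over the $r$-shallow minors of graphs in $\mathcal G$ (minors with a model whose branch sets all induce connected subgraphs of radius at most $r$). An instance $(D,k)$ of Internal Out-Branching (IOB) consists of a finite digraph $D$ with a designated root $r\in V(D)$ and an integer $k\ge 0$; it is a YES-instance if $D$ has an out-branching rooted at $r$ (a spanning tree with all edges oriented away from $r$) in which at least $k$ vertices have positive out-degree. A digraph is said to belong to $\mathcal G$ if its underlying undirected graph does. Then there is an algorithm (which may depend on $\mathcal G$) that, given an instance $(D,k)$ of IOB with $D\in\mathcal G$, runs in time polynomial in $|V(D)|$ (on a random access machine with addition and subtraction of integers as unit-cost operations) and either correctly decides whether $(D,k)$ is a YES-instance, or outputs an instance $(D',k)$ of IOB with the same $k$ such that - $(D',k)$ is a YES-instance if and only if $(D,k)$ is; - $|V(D')|\le c\,k$, where the constant $c$ depends only on $\mathcal G$; - $D'$ is (up to renaming of vertices) an induced subgraph of $D$ containing the root $r$, which is also the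 designated root of $D'$. -/

import Mathlib

open scoped ENNReal

/-! ## Graph classes of bounded expansion -/

/-- A class of finite undirected graphs. Graphs on `n` vertices are represented on the vertex set
`Fin n`; every finite graph is isomorphic to one of these. -/
def GraphClass : Type := (n : ℕ) → Set (SimpleGraph (Fin n))

namespace GraphClass

/-- A class is hereditary if it is closed under induced subgraphs. Graphs being taken up to
isomorphism, "`H` is an induced subgraph of `G`" is an embedding `H ↪g G`; in particular a
hereditary class is closed under isomorphism. -/
def Hereditary (𝒢 : GraphClass) : Prop :=
  ∀ (m n : ℕ) (H : SimpleGraph (Fin m)) (G : SimpleGraph (Fin n)),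
    G ∈ 𝒢 n → Nonempty (H ↪g G) → H ∈ 𝒢 m

/-- `H` is an `r`-shallow minor of `G`: there is a minor model `(I u)`, `u ∈ V(H)`, of `H` in `G`
each of whose branch sets induces a connected subgraph of radius at most `r`. -/
def IsShallowMinor {V W : Type} (r : ℕ) (H : SimpleGraph V) (G : SimpleGraph W) : Prop :=
  ∃ I : V → Set W,
    (∀ u v, u ≠ v → Disjoint (I u) (I v)) ∧
    (∀ u, (G.induce (I u)).Connected ∧ (G.induce (I u)).radius ≤ (r : ℕ∞)) ∧
    (∀ u v, H.Adj u v → ∃ x ∈ I u, ∃ y ∈ I v, G.Adj x y)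

/-- The class of all `r`-shallow minors of graphs from `𝒢`. -/
def shallowMinors (𝒢 : GraphClass) (r : ℕ) : GraphClass :=
  fun _ => {H | ∃ (n : ℕ) (G : SimpleGraph (Fin n)), G ∈ 𝒢 n ∧ IsShallowMinor r H G}

/-- The greatest reduced average degree of `𝒢` at depth `r`: the supremum of `|E(H)| / |V(H)|` over
all `r`-shallow minors `H` of graphs from `𝒢` (the graph without vertices contributes `0`). -/
noncomputable def grad (𝒢 : GraphClass) (r : ℕ) : ℝ≥0∞ :=
  ⨆ (m : ℕ) (H : SimpleGraph (Fin m)) (_ : H ∈ 𝒢.shallowMinors r m),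
    (H.edgeSet.ncard : ℝ≥0∞) / (m : ℝ≥0∞)

/-- A class has bounded expansion if all its grads are finite. -/
def BoundedExpansion (𝒢 : GraphClass) : Prop :=
  ∀ r : ℕ, 𝒢.grad r ≠ ⊤

end GraphClass

/-! ## Internal out-branchings -/

/-- `T` is an out-branching of `D` rooted at `r`: a spanning subdigraph which is a tree with all arcs
directed away from `r`, that is, no arc enters `r`, exactly one arc enters every other vertex, and
every vertex is reachable from `r` along arcs of `T`. -/
structure Digraph.IsOutBranching {V : Type} (D : Digraph V) (r : V) (T : Digraph V) : Prop where
  sub : ∀ u v, T.Adj u v → D.Adj u v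
  root_in : ∀ u, ¬ T.Adj u r
  unique_in : ∀ v, v ≠ r → ∃! u, T.Adj u v
  reach : ∀ v, Relation.ReflTransGen T.Adj r v

/-- The internal vertices of `T`, i.e. those of positive out-degree. -/
def Digraph.internalVertices {V : Type} (T : Digraph V) : Set V :=
  {v | ∃ w, T.Adj v w}

/-- An instance of `k`-Internal Out-Branching: a finite digraph with a designated root, and `k`. -/
structure InternalOutBranching where
  /-- the number of vertices -/
  n : ℕ
  /-- the digraph -/
  D : Digraph (Fin n)
  /-- the root -/
  root : Fin n
  /-- the parameter -/
  k : ℕ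

namespace InternalOutBranching

/-- The instance is a YES-instance: there is an out-branching of `D` rooted at the designated root
with at least `k` internal vertices. -/
def IsYes (X : InternalOutBranching) : Prop :=
  ∃ T : Digraph (Fin X.n), X.D.IsOutBranching X.root T ∧ X.k ≤ T.internalVertices.ncard

/-- The digraph of the instance belongs to a class of undirected graphs if its underlying undirected
graph does. -/
def InClass (X : InternalOutBranching) (𝒢 : GraphClass) : Prop :=
  X.D.toSimpleGraphInclusive ∈ 𝒢 X.n

/-- The rooted digraph of `Y` is (isomorphic to) an induced subgraph of the rooted digraph of `X`,
with the same root. -/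
def IsInducedIn (Y X : InternalOutBranching) : Prop :=
  ∃ f : Fin Y.n ↪ Fin X.n, f Y.root = X.root ∧ ∀ u v, Y.D.Adj u v ↔ X.D.Adj (f u) (f v)

end InternalOutBranching

/-! ## Random access machine programs with a step count

A machine has registers and arrays of natural numbers. A cell of an array is addressed by two
computed indices. The only arithmetic is addition and truncated subtraction, and every evaluation of
a node of an expression or test and every executed instruction takes at least one step. So a number
present after `t` steps has at most `t` bits more than the numbers in the input and the program, and
polynomial time on this machine is the usual polynomial time. -/

namespace Ram

/-- The memory: `reg i` is register `i`, and `arr a i j` is the cell `(i, j)` of array `a`. -/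
@[ext] structure Store where
  /-- registers -/
  reg : ℕ → ℕ
  /-- arrays -/
  arr : ℕ → ℕ → ℕ → ℕ

/-- Expressions: constants, registers, array cells with computed indices, `+` and truncated `-`. -/
inductive Expr where
  | const (c : ℕ)
  | reg (i : ℕ)
  | cell (a : ℕ) (i j : Expr)
  | add (e f : Expr)
  | sub (e f : Expr)

/-- The value of an expression. -/
def Expr.eval (s : Store) : Expr → ℕ
  | .const c => c
  | .reg i => s.reg i
  | .cell a i j => s.arr a (i.eval s) (j.eval s)
  | .add e f => e.eval s + f.eval s
  | .sub e f => e.eval s - f.eval s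

/-- The number of steps that the evaluation of an expression takes: one for each node. -/
def Expr.cost : Expr → ℕ
  | .const _ => 1
  | .reg _ => 1
  | .cell _ i j => i.cost + j.cost + 1
  | .add e f => e.cost + f.cost + 1
  | .sub e f => e.cost + f.cost + 1

/-- Tests. -/
inductive Test where
  | eq (e f : Expr)
  | lt (e f : Expr)
  | not (b : Test)
  | and (b c : Test)

/-- The truth of a test. -/
def Test.Holds (s : Store) : Test → Prop
  | .eq e f => e.eval s = f.eval s
  | .lt e f => e.eval s < f.eval s
  | .not b => ¬ b.Holds s
  | .and b c => b.Holds s ∧ c.Holds s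

/-- The number of steps that the evaluation of a test takes: one for each node. -/
def Test.cost : Test → ℕ
  | .eq e f => e.cost + f.cost + 1
  | .lt e f => e.cost + f.cost + 1
  | .not b => b.cost + 1
  | .and b c => b.cost + c.cost + 1

/-- Programs. -/
inductive Prog where
  | skip
  | assign (i : ℕ) (e : Expr)
  | write (a : ℕ) (i j e : Expr)
  | seq (p q : Prog)
  | cond (b : Test) (p q : Prog)
  | loop (b : Test) (p : Prog)

/-- The store after register `i` has been set to `x`. -/
def Store.setReg (s : Store) (i x : ℕ) : Store :=
  { s with reg := Function.update s.reg i x }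

/-- The store after the cell `(i, j)` of array `a` has been set to `x`. -/
def Store.setCell (s : Store) (a i j x : ℕ) : Store :=
  { s with arr := fun a' i' j' => if a' = a ∧ i' = i ∧ j' = j then x else s.arr a' i' j' }

/-- `Runs p s t s'`: started on the store `s`, the program `p` halts after exactly `t` steps, and `s'`
is then the store. `cond b p q` is "if `b` then `p` else `q`", and `loop b p` is "while `b` do `p`". -/
inductive Runs : Prog → Store → ℕ → Store → Prop where
  | skip (s : Store) : Runs .skip s 1 s
  | assign (i : ℕ) (e : Expr) (s : Store) :
      Runs (.assign i e) s (e.cost + 1) (s.setReg i (e.eval s))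
  | write (a : ℕ) (i j e : Expr) (s : Store) :
      Runs (.write a i j e) s (i.cost + j.cost + e.cost + 1)
        (s.setCell a (i.eval s) (j.eval s) (e.eval s))
  | seq {p q : Prog} {s s' s'' : Store} {t t' : ℕ} :
      Runs p s t s' → Runs q s' t' s'' → Runs (.seq p q) s (t + t') s''
  | cond_true {b : Test} {p q : Prog} {s s' : Store} {t : ℕ} :
      b.Holds s → Runs p s t s' → Runs (.cond b p q) s (b.cost + t) s'
  | cond_false {b : Test} {p q : Prog} {s s' : Store} {t : ℕ} :
      ¬ b.Holds s → Runs q s t s' → Runs (.cond b p q) s (b.cost + t) s'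
  | loop_false {b : Test} {p : Prog} {s : Store} :
      ¬ b.Holds s → Runs (.loop b p) s b.cost s
  | loop_true {b : Test} {p : Prog} {s s' s'' : Store} {t t' : ℕ} :
      b.Holds s → Runs p s t s' → Runs (.loop b p) s' t' s'' →
        Runs (.loop b p) s (b.cost + t + t') s''

/-- The store holds the instance `X`: registers `0`, `1`, `2` are the number of vertices, the root and
`k`, and array `0` is, on the indices below the number of vertices, the adjacency matrix. -/
def Store.HoldsInstance (s : Store) (X : InternalOutBranching) : Prop :=
  s.reg 0 = X.n ∧ s.reg 1 = (X.root : ℕ) ∧ s.reg 2 = X.k ∧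
    ∀ u v : Fin X.n, (X.D.Adj u v → s.arr 0 u v = 1) ∧ (¬ X.D.Adj u v → s.arr 0 u v = 0)

open Classical in
/-- The initial store for the input `X`: it holds `X`, and everything else is `0`. -/
noncomputable def input (X : InternalOutBranching) : Store where
  reg := fun i => if i = 0 then X.n else if i = 1 then (X.root : ℕ) else if i = 2 then X.k else 0
  arr := fun a i j =>
    if a = 0 ∧ ∃ u v : Fin X.n, (u : ℕ) = i ∧ (v : ℕ) = j ∧ X.D.Adj u v then 1 else 0

/-- The initial store indeed holds the input. -/
theorem input_holdsInstance (X : InternalOutBranching) : (input X).HoldsInstance X := by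
  refine ⟨by simp [input], by simp [input], by simp [input], fun u v => ⟨fun h => ?_, fun h => ?_⟩⟩
  · simp only [input]
    rw [if_pos ⟨rfl, u, v, rfl, rfl, h⟩]
  · simp only [input]
    rw [if_neg]
    rintro ⟨-, u', v', hu, hv, h'⟩
    rw [Fin.ext hu, Fin.ext hv] at h'
    exact h h'

/-- In the final store register `3` is the verdict: `0` means "NO-instance", `1` means
"YES-instance", and `2` means that the store holds an output instance. -/
def Store.verdict (s : Store) : ℕ := s.reg 3

end Ram

/-! Two facts carry the kernelization; loops are irrelevant and discarded. First, twins are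
interchangeable. Among more than `|N⁻| + |N⁺|` non-root twins at most `|N⁺|` are internal in a given
out-branching, since their children are distinct out-neighbours. So more than `|N⁻|` are leaves, two
of them share a parent, and one of these can be deleted without loss. Hence it suffices to keep the
root and the first `|N⁻| + |N⁺|` non-root vertices of each twin class
(`hasInternalOutBranchingOn_kept_iff`).

Second, a NO-instance in which every vertex is reachable has a vertex cover `C` of size at most
`2k`: the root, the internal vertices and the only children of an optimal out-branching
(`exists_vertexCover`). Outside `C`, take a maximal set `M` of vertices that can be contracted into
neighbours so as to yield distinct edges on `C`. Sparsity of depth-one minors gives `|M| ≤ d|C|`. By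
maximality, the neighbourhood of any other vertex is a clique of the resulting `2d`-degenerate graph
on `C`, so these vertices can be charged to `|C|` sets of size at most `2d + 1`
(`card_le_of_vertexCover`). Only boundedly many kept vertices have their neighbourhood in such a set
(`card_kept_neighbors_subset_le`). So a NO-instance has at most `ck` kept vertices (`card_kept_le`).

The program therefore answers NO if some vertex is unreachable, YES if more than `ck` vertices are
kept, and otherwise outputs the subgraph induced by the kept vertices (`exec_kernelize`). -/

/-! ## Out-branchings on a set of vertices -/

/-- `T` is an out-branching rooted at `r` of the restriction of the relation `E` to `S`. -/
structure IsOutBranchingOn {V : Type} (E : V → V → Prop) (S : Set V) (r : V) (T : V → V → Prop) :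
    Prop where
  sub : ∀ {u v}, T u v → E u v
  left_mem : ∀ {u v}, T u v → u ∈ S
  right_mem : ∀ {u v}, T u v → v ∈ S
  root_in : ∀ {u}, ¬ T u r
  exists_in : ∀ {v}, v ∈ S → v ≠ r → ∃ u, T u v
  unique_in : ∀ {u u' v}, T u v → T u' v → u = u'
  reach : ∀ {v}, v ∈ S → Relation.ReflTransGen T r v

/-- The restriction of `E` to `S` has an out-branching with at least `k` internal vertices. -/
def HasInternalOutBranchingOn {V : Type} (E : V → V → Prop) (S : Set V) (r : V) (k : ℕ) : Prop :=
  ∃ T, IsOutBranchingOn E S r T ∧ k ≤ {v | ∃ w, T v w}.ncard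

/-- `u` and `v` have the same in-neighbours and the same out-neighbours. -/
def AreTwins {V : Type} (E : V → V → Prop) (u v : V) : Prop :=
  ∀ w, (E u w ↔ E v w) ∧ (E w u ↔ E w v)

/-- The arcs of a digraph that are not loops. -/
def Digraph.ProperAdj {V : Type} (D : Digraph V) (u v : V) : Prop := D.Adj u v ∧ u ≠ v

section OutBranching

variable {V : Type} {E : V → V → Prop} {S : Set V} {r : V} {k : ℕ} {T : V → V → Prop}

theorem AreTwins.refl (v : V) : AreTwins E v v := fun _ => ⟨Iff.rfl, Iff.rfl⟩

theorem AreTwins.symm {u v : V} (h : AreTwins E u v) : AreTwins E v u :=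
  fun w => ⟨(h w).1.symm, (h w).2.symm⟩

theorem AreTwins.trans {u v w : V} (h : AreTwins E u v) (h' : AreTwins E v w) : AreTwins E u w :=
  fun x => ⟨(h x).1.trans (h' x).1, (h x).2.trans (h' x).2⟩

/-- Invariance in each argument separately suffices, so transposing twins is an automorphism of `E`.
-/
theorem AreTwins.swap_apply_iff [DecidableEq V] {u v : V} (h : AreTwins E u v) (x y : V) :
    E (Equiv.swap u v x) (Equiv.swap u v y) ↔ E x y := by
  have h1 : ∀ x z, E (Equiv.swap u v x) z ↔ E x z := by
    intro x z
    rw [Equiv.swap_apply_def]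
    split_ifs with h1 h2
    · rw [h1, (h z).1]
    · rw [h2, (h z).1]
    · rfl
  have h2 : ∀ z y, E z (Equiv.swap u v y) ↔ E z y := by
    intro z y
    rw [Equiv.swap_apply_def]
    split_ifs with h1 h2
    · rw [h1, (h z).2]
    · rw [h2, (h z).2]
    · rfl
  rw [h1, h2]

/-- A vertex with a loop in `T` would be its own only in-neighbour, so no walk from the root could
arrive there. This is why `ProperAdj` may replace `D.Adj`. -/
theorem Digraph.IsOutBranching.ne {D : Digraph V} {T : Digraph V} (hT : D.IsOutBranching r T)
    {u v : V} (h : T.Adj u v) : u ≠ v := by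
  rintro rfl
  have : ∀ z, Relation.ReflTransGen T.Adj r z → z ≠ u := by
    intro z hz
    induction hz with
    | refl => rintro rfl; exact hT.root_in _ h
    | @tail y z _ hyz ih =>
      rintro rfl
      have hz : z ≠ r := by rintro rfl; exact hT.root_in _ h
      exact ih ((hT.unique_in z hz).unique hyz h)
  exact this u (hT.reach u) rfl

/-- Out-branchings of an induced subgraph are out-branchings on the range of the embedding. -/
theorem InternalOutBranching.isYes_iff {Y X : InternalOutBranching} (f : Fin Y.n ↪ Fin X.n)
    (hr : f Y.root = X.root) (hf : ∀ u v, Y.D.Adj u v ↔ X.D.Adj (f u) (f v)) :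
    Y.IsYes ↔ HasInternalOutBranchingOn X.D.ProperAdj (Set.range f) X.root Y.k := by
  constructor
  · rintro ⟨T, hT, hk⟩
    refine ⟨fun a b => ∃ x y, T.Adj x y ∧ f x = a ∧ f y = b, ⟨?_, ?_, ?_, ?_, ?_, ?_, ?_⟩, ?_⟩
    · rintro _ _ ⟨x, y, h, rfl, rfl⟩
      exact ⟨(hf _ _).1 (hT.sub _ _ h), fun h' => hT.ne h (f.injective h')⟩
    · rintro _ _ ⟨x, y, h, rfl, rfl⟩
      exact ⟨x, rfl⟩
    · rintro _ _ ⟨x, y, h, rfl, rfl⟩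
      exact ⟨y, rfl⟩
    · rintro _ ⟨x, y, h, rfl, h'⟩
      rw [← hr] at h'
      cases f.injective h'
      exact hT.root_in _ h
    · rintro _ ⟨v, rfl⟩ hv
      obtain ⟨u, hu, -⟩ := hT.unique_in v (by rintro rfl; exact hv hr)
      exact ⟨f u, u, v, hu, rfl, rfl⟩
    · rintro _ _ _ ⟨x, y, h, rfl, rfl⟩ ⟨x', y', h', rfl, hy⟩
      cases f.injective hy
      have hy : y ≠ Y.root := by rintro rfl; exact hT.root_in _ h
      rw [(hT.unique_in y hy).unique h h']
    · rintro _ ⟨v, rfl⟩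
      rw [← hr]
      exact (hT.reach v).lift f fun a b h => ⟨a, b, h, rfl, rfl⟩
    · refine hk.trans ?_
      rw [← Set.ncard_image_of_injective _ f.injective]
      refine Set.ncard_le_ncard ?_ (Set.toFinite _)
      rintro _ ⟨x, ⟨y, h⟩, rfl⟩
      exact ⟨f y, x, y, h, rfl, rfl⟩
  · rintro ⟨T, hT, hk⟩
    refine ⟨⟨fun x y => T (f x) (f y)⟩, ⟨?_, ?_, ?_, ?_⟩, ?_⟩
    · exact fun u v h => (hf _ _).2 (hT.sub h).1
    · intro u h
      change T (f u) (f Y.root) at h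
      rw [hr] at h
      exact hT.root_in h
    · intro v hv
      obtain ⟨u, hu⟩ := hT.exists_in (Set.mem_range_self v)
        (by rw [← hr]; exact fun h => hv (f.injective h))
      obtain ⟨x, rfl⟩ := hT.left_mem hu
      exact ⟨x, hu, fun y hy => f.injective (hT.unique_in hy hu)⟩
    · have : ∀ b, Relation.ReflTransGen T X.root b → ∀ y, f y = b →
          Relation.ReflTransGen (fun x y => T (f x) (f y)) Y.root y := by
        intro b hb
        induction hb with
        | refl =>
          intro y hy
          rw [← hr] at hy
          cases f.injective hy
          exact .refl
        | tail _ h ih =>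
          rintro y rfl
          obtain ⟨x, rfl⟩ := hT.left_mem h
          exact (ih x rfl).tail h
      exact fun v => this _ (hT.reach (Set.mem_range_self v)) v rfl
    · refine hk.trans ?_
      rw [← Set.ncard_image_of_injective _ f.injective]
      refine Set.ncard_le_ncard ?_ (Set.toFinite _)
      rintro v ⟨w, h⟩
      obtain ⟨x, rfl⟩ := hT.left_mem h
      obtain ⟨y, rfl⟩ := hT.right_mem h
      exact ⟨x, ⟨y, h⟩, rfl⟩

theorem InternalOutBranching.isYes_iff_univ (X : InternalOutBranching) :
    X.IsYes ↔ HasInternalOutBranchingOn X.D.ProperAdj Set.univ X.root X.k := by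
  rw [X.isYes_iff (Function.Embedding.refl _) rfl fun _ _ => Iff.rfl]
  exact iff_of_eq (congrArg (HasInternalOutBranchingOn _ · _ _) Set.range_id)

/-- A new leaf can be attached to any vertex. -/
theorem HasInternalOutBranchingOn.insert_leaf [Finite V] {v p : V}
    (h : HasInternalOutBranchingOn E (S \ {v}) r k) (hv : v ∈ S) (hvr : v ≠ r) (hpv : p ≠ v)
    (hp : p ∈ S) (hE : E p v) : HasInternalOutBranchingOn E S r k := by
  obtain ⟨T, hT, hk⟩ := h
  refine ⟨fun x y => T x y ∨ x = p ∧ y = v, ⟨?_, ?_, ?_, ?_, ?_, ?_, ?_⟩, ?_⟩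
  · rintro x y (h | ⟨rfl, rfl⟩)
    exacts [hT.sub h, hE]
  · rintro x y (h | ⟨rfl, rfl⟩)
    exacts [(hT.left_mem h).1, hp]
  · rintro x y (h | ⟨rfl, rfl⟩)
    exacts [(hT.right_mem h).1, hv]
  · rintro x (h | ⟨-, h⟩)
    exacts [hT.root_in h, hvr h.symm]
  · intro x hx hxr
    by_cases hxv : x = v
    · exact ⟨p, Or.inr ⟨rfl, hxv⟩⟩
    · obtain ⟨u, hu⟩ := hT.exists_in ⟨hx, hxv⟩ hxr
      exact ⟨u, Or.inl hu⟩
  · rintro x x' y (h | ⟨rfl, rfl⟩) (h' | ⟨rfl, h'⟩)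
    · exact hT.unique_in h h'
    · exact absurd h' (hT.right_mem h).2
    · exact absurd rfl (hT.right_mem h').2
    · rfl
  · have key : ∀ x ∈ S, x ≠ v →
        Relation.ReflTransGen (fun x y => T x y ∨ x = p ∧ y = v) r x :=
      fun x hx hxv => Relation.ReflTransGen.mono (fun a b h => Or.inl h) _ _ (hT.reach ⟨hx, hxv⟩)
    intro x hx
    by_cases hxv : x = v
    · exact (key p hp hpv).tail (Or.inr ⟨rfl, hxv⟩)
    · exact key x hx hxv
  · refine hk.trans (Set.ncard_le_ncard ?_ (Set.toFinite _))
    rintro x ⟨y, h⟩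
    exact ⟨y, Or.inl h⟩

/-- A leaf with a sibling can be removed. -/
theorem IsOutBranchingOn.remove_leaf {v p w : V} (hT : IsOutBranchingOn E S r T) (hvr : v ≠ r)
    (hleaf : ∀ x, ¬ T v x) (hp : T p v) (hw : T p w) (hwv : w ≠ v) :
    HasInternalOutBranchingOn E (S \ {v}) r {v | ∃ w, T v w}.ncard := by
  have hne : ∀ {x y}, T x y → x ≠ v := by rintro x y h rfl; exact hleaf y h
  refine ⟨fun x y => T x y ∧ y ≠ v, ⟨?_, ?_, ?_, ?_, ?_, ?_, ?_⟩, ?_⟩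
  · exact fun h => hT.sub h.1
  · exact fun h => ⟨hT.left_mem h.1, hne h.1⟩
  · exact fun h => ⟨hT.right_mem h.1, h.2⟩
  · exact fun h => hT.root_in h.1
  · rintro x ⟨hx, hxv⟩ hxr
    obtain ⟨u, hu⟩ := hT.exists_in hx hxr
    exact ⟨u, hu, hxv⟩
  · exact fun h h' => hT.unique_in h.1 h'.1
  · have : ∀ x, Relation.ReflTransGen T r x → x ≠ v →
        Relation.ReflTransGen (fun x y => T x y ∧ y ≠ v) r x := by
      intro x hx
      induction hx with
      | refl => exact fun _ => .refl
      | tail _ h ih => exact fun hv => (ih (hne h)).tail ⟨h, hv⟩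
    exact fun {x} hx => this x (hT.reach hx.1) hx.2
  · refine le_of_eq (congrArg Set.ncard ?_)
    ext x
    constructor
    -- The parent `p` of `v` stays internal thanks to the sibling `w`.
    · rintro ⟨y, h⟩
      by_cases hy : y = v
      · subst hy
        cases hT.unique_in h hp
        exact ⟨w, hw, hwv⟩
      · exact ⟨y, h, hy⟩
    · rintro ⟨y, h, -⟩
      exact ⟨y, h⟩

/-- The transposition is an automorphism of `E` that fixes `r` and preserves `S`. -/
theorem IsOutBranchingOn.swap [DecidableEq V] {u v : V} (hT : IsOutBranchingOn E S r T)
    (h : AreTwins E u v) (hu : u ∈ S) (hv : v ∈ S) (hur : u ≠ r) (hvr : v ≠ r) :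
    IsOutBranchingOn E S r fun x y => T (Equiv.swap u v x) (Equiv.swap u v y) := by
  have hS : ∀ x, Equiv.swap u v x ∈ S ↔ x ∈ S := by
    intro x
    rw [Equiv.swap_apply_def]
    split_ifs with h1 h2
    · rw [h1]; exact iff_of_true hv hu
    · rw [h2]; exact iff_of_true hu hv
    · rfl
  have hr : Equiv.swap u v r = r := Equiv.swap_apply_of_ne_of_ne hur.symm hvr.symm
  refine ⟨?_, ?_, ?_, ?_, ?_, ?_, ?_⟩
  · exact fun h' => (h.swap_apply_iff _ _).1 (hT.sub h')
  · exact fun h' => (hS _).1 (hT.left_mem h')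
  · exact fun h' => (hS _).1 (hT.right_mem h')
  · intro x hx
    rw [hr] at hx
    exact hT.root_in hx
  · intro x hx hxr
    obtain ⟨w, hw⟩ := hT.exists_in ((hS x).2 hx) (by
      intro h'
      rw [Equiv.swap_apply_eq_iff, hr] at h'
      exact hxr h')
    exact ⟨Equiv.swap u v w, by simpa using hw⟩
  · intro x x' y hx hx'
    exact (Equiv.swap u v).injective (hT.unique_in hx hx')
  · intro x hx
    have := (hT.reach ((hS x).2 hx)).lift
      (p := fun x y => T (Equiv.swap u v x) (Equiv.swap u v y)) (Equiv.swap u v)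
      (fun a b h => by simpa [Function.onFun] using h)
    simpa [hr, Function.onFun] using this

/-- Among more than `|N⁻| + |N⁺|` twins, two are leaves with the same parent. -/
theorem IsOutBranchingOn.exists_twin_leaves [Fintype V] {v : V}
    (hT : IsOutBranchingOn E S r T) (K : Finset V)
    (hK : ∀ u ∈ K, u ∈ S ∧ u ≠ r ∧ AreTwins E u v)
    (hcard : {w | E v w}.ncard + {w | E w v}.ncard < K.card) :
    ∃ u ∈ K, ∃ w, u ≠ w ∧ ∃ p, T p u ∧ T p w ∧ ∀ x, ¬ T u x := by
  classical
  -- Choosing a child for each internal twin is injective, and all these children are out-neighbours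
  -- of `v`.
  have h1 : (K.filter fun u => ∃ x, T u x).card ≤ {w | E v w}.ncard := by
    have hx : ∀ u ∈ K.filter fun u => ∃ x, T u x, ∃ x, T u x := fun u hu =>
      (Finset.mem_filter.1 hu).2
    choose! g hg using hx
    rw [Set.ncard_eq_toFinset_card']
    refine Finset.card_le_card_of_injOn g ?_ ?_
    · intro u hu
      simp only [Set.coe_toFinset, Set.mem_ofPred_eq]
      exact ((hK u (Finset.mem_filter.1 hu).1).2.2 _).1.1 (hT.sub (hg u hu))
    · intro u hu u' hu' h
      have := hg u hu
      rw [h] at this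
      exact hT.unique_in this (hg u' hu')
  -- So the leaves in `K` outnumber the in-neighbours of `v`, among which all their parents lie.
  have h2 : {w | E w v}.ncard < (K.filter fun u => ¬ ∃ x, T u x).card := by
    have := Finset.card_filter_add_card_filter_not (s := K) (fun u => ∃ x, T u x)
    omega
  have hp : ∀ u ∈ K, ∃ p, T p u := fun u hu => hT.exists_in (hK u hu).1 (hK u hu).2.1
  choose! g hg using hp
  rw [Set.ncard_eq_toFinset_card'] at h2
  obtain ⟨u, hu, w, hw, hne, h⟩ := Finset.exists_ne_map_eq_of_card_lt_of_maps_to (f := g) h2 (by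
    intro u hu
    have hu := (Finset.mem_filter.1 hu).1
    simp only [Set.coe_toFinset, Set.mem_ofPred_eq]
    exact ((hK u hu).2.2 _).2.1 (hT.sub (hg u hu)))
  have hu' := Finset.mem_filter.1 hu
  refine ⟨u, hu'.1, w, hne, g u, hg u hu'.1, ?_, fun x hx => hu'.2 ⟨x, hx⟩⟩
  rw [h]
  exact hg w (Finset.mem_filter.1 hw).1

/-- A vertex with at least `|N⁻| + |N⁺|` further twins is irrelevant. -/
theorem hasInternalOutBranchingOn_diff_singleton_iff [Fintype V] {v : V} (K : Finset V)
    (hv : v ∈ S) (hvr : v ≠ r) (hK : ∀ u ∈ K, u ∈ S ∧ u ≠ r ∧ u ≠ v ∧ AreTwins E u v)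
    (hcard : {w | E v w}.ncard + {w | E w v}.ncard ≤ K.card) (hne : K.Nonempty) :
    HasInternalOutBranchingOn E (S \ {v}) r k ↔ HasInternalOutBranchingOn E S r k := by
  classical
  constructor
  · intro h
    -- `v` is hung below the parent of a twin, which is an in-neighbour of `v` too.
    obtain ⟨u, hu⟩ := hne
    obtain ⟨huS, hur, huv, htw⟩ := hK u hu
    obtain ⟨T, hT, -⟩ := id h
    obtain ⟨p, hp⟩ := hT.exists_in ⟨huS, huv⟩ hur
    exact h.insert_leaf hv hvr (hT.left_mem hp).2 (hT.left_mem hp).1 ((htw p).2.1 (hT.sub hp))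
  · rintro ⟨T, hT, hk⟩
    have hvK : v ∉ K := fun h => (hK v h).2.2.1 rfl
    -- With `v` included there are enough twins for two sibling leaves; transposing one of them with
    -- `v` makes `v` the leaf to delete.
    obtain ⟨u, hu, w, huw, p, hpu, hpw, hleaf⟩ := hT.exists_twin_leaves (v := v) (insert v K) (by
        intro u hu
        rcases Finset.mem_insert.1 hu with rfl | hu
        · exact ⟨hv, hvr, AreTwins.refl _⟩
        · exact ⟨(hK u hu).1, (hK u hu).2.1, (hK u hu).2.2.2⟩)
      (by rw [Finset.card_insert_of_notMem hvK]; omega)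
    have hu' : u ∈ S ∧ u ≠ r ∧ AreTwins E u v := by
      rcases Finset.mem_insert.1 hu with rfl | hu
      · exact ⟨hv, hvr, AreTwins.refl _⟩
      · exact ⟨(hK u hu).1, (hK u hu).2.1, (hK u hu).2.2.2⟩
    have hT' := hT.swap hu'.2.2 hu'.1 hv hu'.2.1 hvr
    obtain ⟨T'', hT'', hk'⟩ := hT'.remove_leaf (v := v) (p := Equiv.swap u v p)
      (w := Equiv.swap u v w) hvr (by intro x; simpa using hleaf _) (by simpa using hpu)
      (by simpa using hpw) (by
        intro h
        rw [Equiv.swap_apply_eq_iff, Equiv.swap_apply_right] at h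
        exact huw h.symm)
    refine ⟨T'', hT'', hk.trans (le_trans (le_of_eq ?_) hk')⟩
    rw [← Set.ncard_image_of_injective _ (Equiv.swap u v).injective]
    congr 1
    ext x
    constructor
    · rintro ⟨y, ⟨z, h⟩, rfl⟩
      exact ⟨Equiv.swap u v z, by simpa using h⟩
    · rintro ⟨z, h⟩
      exact ⟨Equiv.swap u v x, ⟨_, h⟩, by simp⟩

/-- A digraph has an out-branching if every vertex is reachable from the root. -/
theorem exists_isOutBranchingOn_univ (h : ∀ v, Relation.ReflTransGen E r v) :
    ∃ T, IsOutBranchingOn E Set.univ r T := by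
  classical
  -- `d` is the distance from the root; choosing a strictly closer predecessor for every vertex
  -- gives the tree.
  have hd : ∃ d : V → ℕ, ∀ v, v ≠ r → ∃ u, E u v ∧ d u < d v := by
    let R : ℕ → V → Prop := fun n => Nat.rec (fun v => v = r) (fun _ P v => ∃ u, P u ∧ E u v) n
    have hR : ∀ v, ∃ n, R n v := by
      intro v
      induction h v with
      | refl => exact ⟨0, rfl⟩
      | tail _ h ih =>
        obtain ⟨n, hn⟩ := ih
        exact ⟨n + 1, _, hn, h⟩
    have hmin : ∀ v, ∃ n, R n v ∧ ∀ m, R m v → n ≤ m := fun v =>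
      ⟨sInf {n | R n v}, Nat.sInf_mem (hR v), fun m hm => Nat.sInf_le hm⟩
    choose d hs hmin using hmin
    refine ⟨d, fun v hv => ?_⟩
    specialize hs v
    rcases hm : d v with _ | m
    · rw [hm] at hs
      exact absurd hs hv
    · rw [hm] at hs
      obtain ⟨u, hu, huv⟩ := hs
      exact ⟨u, huv, Nat.lt_succ_of_le (hmin u m hu)⟩
  obtain ⟨d, hd⟩ := hd
  choose! g hg using hd
  refine ⟨fun u v => v ≠ r ∧ u = g v, ⟨?_, ?_, ?_, ?_, ?_, ?_, ?_⟩⟩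
  · rintro u v ⟨hv, rfl⟩
    exact (hg v hv).1
  · exact fun _ => trivial
  · exact fun _ => trivial
  · exact fun h => h.1 rfl
  · exact fun {v} _ hv => ⟨g v, hv, rfl⟩
  · rintro u u' v ⟨-, rfl⟩ ⟨-, rfl⟩
    rfl
  · intro v _
    induction hn : d v using Nat.strong_induction_on generalizing v with
    | _ n ih =>
      subst hn
      by_cases hv : v = r
      · rw [hv]
      · exact (ih _ (hg v hv).2 (v := g v) trivial rfl).tail ⟨hv, rfl⟩

/-- An out-branching becomes better when a leaf `v` with a sibling is moved below another leaf. -/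
theorem IsOutBranchingOn.move_leaf [Finite V] {u v p w : V}
    (hT : IsOutBranchingOn E Set.univ r T) (hvr : v ≠ r) (hu : ∀ x, ¬ T u x) (hv : ∀ x, ¬ T v x)
    (huv : u ≠ v) (hE : E u v) (hp : T p v) (hw : T p w) (hwv : w ≠ v) :
    HasInternalOutBranchingOn E Set.univ r ({v | ∃ w, T v w}.ncard + 1) := by
  have hne : ∀ {x y}, T x y → x ≠ v := by rintro x y h rfl; exact hv y h
  refine ⟨fun x y => T x y ∧ y ≠ v ∨ x = u ∧ y = v, ⟨?_, ?_, ?_, ?_, ?_, ?_, ?_⟩, ?_⟩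
  · rintro x y (h | ⟨rfl, rfl⟩)
    exacts [hT.sub h.1, hE]
  · exact fun _ => trivial
  · exact fun _ => trivial
  · rintro x (h | h)
    exacts [hT.root_in h.1, hvr h.2.symm]
  · intro x hx hxr
    by_cases hxv : x = v
    · exact ⟨u, Or.inr ⟨rfl, hxv⟩⟩
    · obtain ⟨y, hy⟩ := hT.exists_in hx hxr
      exact ⟨y, Or.inl ⟨hy, hxv⟩⟩
  · rintro x x' y (h | ⟨rfl, rfl⟩) (h' | ⟨rfl, h'⟩)
    · exact hT.unique_in h.1 h'.1
    · exact absurd h' h.2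
    · exact absurd rfl h'.2
    · rfl
  · have key : ∀ x, Relation.ReflTransGen T r x → x ≠ v →
        Relation.ReflTransGen (fun x y => T x y ∧ y ≠ v ∨ x = u ∧ y = v) r x := by
      intro x hx
      induction hx with
      | refl => exact fun _ => .refl
      | tail _ h ih => exact fun hxv => (ih (hne h)).tail (Or.inl ⟨h, hxv⟩)
    intro x _
    by_cases hxv : x = v
    · exact (key u (hT.reach trivial) huv).tail (Or.inr ⟨rfl, hxv⟩)
    · exact key x (hT.reach trivial) hxv
  -- `u` becomes internal, and `p` stays internal because of `w`.
  · rw [← Set.ncard_insert_of_notMem (a := u) (by rintro ⟨x, hx⟩; exact hu x hx) (Set.toFinite _)]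
    refine Set.ncard_le_ncard ?_ (Set.toFinite _)
    rintro x (rfl | ⟨y, h⟩)
    · exact ⟨v, Or.inr ⟨rfl, rfl⟩⟩
    · by_cases hy : y = v
      · subst hy
        cases hT.unique_in h hp
        exact ⟨w, Or.inl ⟨hw, hwv⟩⟩
      · exact ⟨y, Or.inl ⟨h, hy⟩⟩

/-- If all vertices are reachable but no out-branching has `k` internal vertices, then there is a
vertex cover with at most `2k` vertices. -/
theorem exists_vertexCover [Fintype V] (h : ∀ v, Relation.ReflTransGen E r v)
    (hno : ¬ HasInternalOutBranchingOn E Set.univ r k) :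
    ∃ C : Finset V, r ∈ C ∧ C.card ≤ 2 * k ∧ ∀ u v, u ∉ C → v ∉ C → u ≠ v → ¬ E u v := by
  classical
  have h0 : HasInternalOutBranchingOn E Set.univ r 0 := by
    obtain ⟨T, hT⟩ := exists_isOutBranchingOn_univ h
    exact ⟨T, hT, Nat.zero_le _⟩
  -- `j` is the largest attainable number of internal vertices.
  obtain ⟨j, hj, hj', hjk⟩ : ∃ j, HasInternalOutBranchingOn E Set.univ r j ∧
      ¬ HasInternalOutBranchingOn E Set.univ r (j + 1) ∧ j < k := by
    by_contra! hcon
    have : ∀ j, j ≤ k → HasInternalOutBranchingOn E Set.univ r j := by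
      intro j
      induction j with
      | zero => exact fun _ => h0
      | succ j ih =>
        intro hj
        by_contra hc
        exact absurd (hcon j (ih (by omega)) hc) (by omega)
    exact hno (this k le_rfl)
  obtain ⟨T, hT, hk⟩ := hj
  have hmax : ¬ HasInternalOutBranchingOn E Set.univ r ({v | ∃ w, T v w}.ncard + 1) := by
    rintro ⟨T', hT', hk'⟩
    exact hj' ⟨T', hT', by omega⟩
  have hlt : {v | ∃ w, T v w}.ncard ≤ j := by
    by_contra hc
    exact hj' ⟨T, hT, by omega⟩
  rw [Set.ncard_eq_toFinset_card'] at hlt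
  set I := {v | ∃ w, T v w}.toFinset with hI
  -- `O` consists of the only children; sending each to its parent shows `|O| ≤ |I|`.
  let O : Finset V := Finset.univ.filter fun v => ∃ p, T p v ∧ ∀ w, T p w → w = v
  have hO : O.card ≤ I.card := by
    have hx : ∀ v ∈ O, ∃ p, T p v ∧ ∀ w, T p w → w = v := fun v hv => (Finset.mem_filter.1 hv).2
    choose! g hg using hx
    refine Finset.card_le_card_of_injOn g ?_ ?_
    · intro v hv
      simp only [hI, Set.coe_toFinset, Set.mem_ofPred_eq]
      exact ⟨v, (hg v hv).1⟩
    · intro v hv v' hv' hvv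
      refine (hg v' hv').2 v ?_
      rw [← hvv]
      exact (hg v hv).1
  refine ⟨insert r (I ∪ O), by simp, ?_, ?_⟩
  -- The cover has at most `1 + 2j` vertices, and `j < k`.
  · have := Finset.card_insert_le r (I ∪ O)
    have := Finset.card_union_le I O
    omega
  -- Both ends would be leaves and `v` would have a sibling, so moving `v` below `u` would improve
  -- an optimal out-branching.
  · intro u v hu hv huv hE
    simp only [hI, O, Finset.mem_insert, Finset.mem_union, Set.mem_toFinset, Set.mem_ofPred_eq,
      Finset.mem_filter, Finset.mem_univ, true_and, not_or, not_exists, not_and] at hu hv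
    obtain ⟨p, hp⟩ := hT.exists_in (v := v) trivial hv.1
    obtain ⟨w, hw⟩ := not_forall.1 (hv.2.2 p hp)
    obtain ⟨hw, hwv⟩ := Classical.not_imp.1 hw
    exact hmax (hT.move_leaf hv.1 hu.2.1 hv.2.1 huv hE hp hw hwv)

end OutBranching

/-! ## Shallow minors of depth one -/

section ShallowMinor

/-- A set spanned by a star has radius at most one. -/
theorem SimpleGraph.radius_induce_le_one {V : Type} {G : SimpleGraph V} {I : Set V} {c : V}
    (hc : c ∈ I) (h : ∀ x ∈ I, x ≠ c → G.Adj c x) : (G.induce I).radius ≤ 1 := by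
  refine (SimpleGraph.radius_le_eccent (u := ⟨c, hc⟩)).trans ?_
  rw [SimpleGraph.eccent_le_iff]
  rintro ⟨x, hx⟩
  by_cases hxc : x = c
  · subst hxc
    simp
  · exact (SimpleGraph.edist_eq_one_iff_adj.2 (show (G.induce I).Adj ⟨c, hc⟩ ⟨x, hx⟩ from
      h x hx hxc)).le

/-- A graph that is not connected has infinite radius, so the radius bound already forces
connectedness. -/
theorem SimpleGraph.connected_induce_of_star {V : Type} {G : SimpleGraph V} {I : Set V} {c : V}
    (hc : c ∈ I) (h : ∀ x ∈ I, x ≠ c → G.Adj c x) : (G.induce I).Connected := by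
  by_contra hcon
  have := SimpleGraph.radius_induce_le_one hc h
  rw [SimpleGraph.radius_eq_top_of_not_connected hcon] at this
  exact absurd this (by simp)

/-- The shallow minors of the graphs of a class of bounded expansion are uniformly sparse. -/
theorem GraphClass.BoundedExpansion.exists_edge_bound {𝒢 : GraphClass} (h : 𝒢.BoundedExpansion)
    (r : ℕ) : ∃ d : ℕ, ∀ (n : ℕ) (G : SimpleGraph (Fin n)), G ∈ 𝒢 n →
      ∀ (W : Type) [Fintype W] (H : SimpleGraph W), GraphClass.IsShallowMinor r H G →
        H.edgeSet.ncard ≤ d * Fintype.card W := by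
  obtain ⟨d, hd⟩ := ENNReal.exists_nat_gt (h r)
  refine ⟨d, fun n G hG W _ H hH => ?_⟩
  let e := Fintype.equivFin W
  let H' : SimpleGraph (Fin (Fintype.card W)) := H.map e.toEmbedding
  have hiso : H ≃g H' := SimpleGraph.Iso.map e H
  have hmem : H' ∈ 𝒢.shallowMinors r (Fintype.card W) := by
    obtain ⟨I, h1, h2, h3⟩ := hH
    refine ⟨n, G, hG, fun u => I (hiso.symm u), ?_, fun u => h2 _, ?_⟩
    · exact fun u v huv => h1 _ _ fun h' => huv (hiso.symm.injective h')
    · exact fun u v huv => h3 _ _ (hiso.symm.map_adj_iff.2 huv)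
  have hle : (H'.edgeSet.ncard : ℝ≥0∞) / (Fintype.card W : ℝ≥0∞) ≤ d := by
    refine le_trans ?_ hd.le
    exact le_iSup_of_le (Fintype.card W) (le_iSup_of_le H' (le_iSup_of_le hmem le_rfl))
  have hcard : H.edgeSet.ncard = H'.edgeSet.ncard := by
    rw [← Nat.card_coe_set_eq, ← Nat.card_coe_set_eq]
    exact Nat.card_congr hiso.mapEdgeSet
  rw [hcard]
  -- Clearing the denominator needs a nonempty vertex set; without vertices there are no edges.
  by_cases h0 : Fintype.card W = 0
  · have : IsEmpty (Fin (Fintype.card W)) := by rw [h0]; infer_instance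
    have : H'.edgeSet = ∅ := by
      rw [SimpleGraph.edgeSet_eq_empty]
      exact Subsingleton.elim _ _
    simp [this]
  · rw [ENNReal.div_le_iff (by exact_mod_cast h0) (by simp)] at hle
    exact_mod_cast hle

/-! ### Contractions into a vertex cover, and degenerate graphs. -/

variable {V : Type}

/-- The graph whose edges are the pairs `p v`, `q v`, for `v ∈ M`. -/
def pairGraph (M : Finset V) (p q : V → V) : SimpleGraph V where
  Adj x y := x ≠ y ∧ ∃ v ∈ M, s(p v, q v) = s(x, y)
  symm := ⟨fun x y h => ⟨h.1.symm, by
    obtain ⟨v, hv, h⟩ := h.2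
    exact ⟨v, hv, h.trans Sym2.eq_swap⟩⟩⟩
  loopless := ⟨fun _ h => h.1 rfl⟩

theorem pairGraph_adj {M : Finset V} {p q : V → V} {x y : V} :
    (pairGraph M p q).Adj x y ↔ x ≠ y ∧ ∃ v ∈ M, s(p v, q v) = s(x, y) := Iff.rfl

/-- Contract each `v ∈ M` into `p v`: the branch set of `x` is a star centred at `x`, and the edge
from `v` to `q v` realizes the pair. Disjointness of `M` and `S` keeps the branch sets apart. -/
theorem isShallowMinor_pairGraph {G : SimpleGraph V} {M S : Finset V} {p q : V → V}
    (hMS : Disjoint M S) (hp : ∀ v ∈ M, G.Adj (p v) v) (hq : ∀ v ∈ M, G.Adj v (q v)) :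
    GraphClass.IsShallowMinor 1 ((pairGraph M p q).induce (S : Set V)) G := by
  have hMS' : ∀ {v}, v ∈ M → v ∉ S := fun hv hv' => Finset.disjoint_left.1 hMS hv hv'
  have hstar : ∀ x : V, ∀ y ∈ ({y | y = x ∨ y ∈ M ∧ p y = x} : Set V), y ≠ x → G.Adj x y := by
    rintro x y (rfl | ⟨hy, rfl⟩) hxy
    · exact absurd rfl hxy
    · exact hp y hy
  refine ⟨fun x => {y | y = x ∨ y ∈ M ∧ p y = x}, ?_, ?_, ?_⟩
  · rintro ⟨x, hx⟩ ⟨x', hx'⟩ hne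
    rw [Set.disjoint_left]
    rintro y (rfl | ⟨hy, rfl⟩) (h | ⟨hy', h⟩)
    · exact hne (Subtype.ext h)
    · exact hMS' hy' hx
    · exact hMS' hy (by rw [h]; exact hx')
    · exact hne (Subtype.ext h)
  · exact fun x => ⟨SimpleGraph.connected_induce_of_star (Or.inl rfl) (hstar x),
      SimpleGraph.radius_induce_le_one (Or.inl rfl) (hstar x)⟩
  · rintro ⟨x, hx⟩ ⟨y, hy⟩ h
    obtain ⟨-, v, hv, h⟩ := pairGraph_adj.1 (SimpleGraph.induce_adj.1 h)
    rw [Sym2.eq_iff] at h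
    rcases h with ⟨h1, h2⟩ | ⟨h1, h2⟩
    · exact ⟨v, Or.inr ⟨hv, h1⟩, y, Or.inl rfl, by
        simpa [h2] using hq v hv⟩
    · exact ⟨x, Or.inl rfl, v, Or.inr ⟨hv, h1⟩, by
        simpa [h2] using (hq v hv).symm⟩

/-- A graph on `S` with at most `d * |S|` edges has a vertex of degree at most `2 * d`. -/
theorem SimpleGraph.exists_card_adj_le {H : SimpleGraph V} [DecidableRel H.Adj] {S : Finset V}
    (hS : S.Nonempty) {d : ℕ} (h : (H.induce (S : Set V)).edgeSet.ncard ≤ d * S.card) :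
    ∃ x ∈ S, (S.filter fun y => H.Adj x y).card ≤ 2 * d := by
  classical
  -- Otherwise the handshake identity would give `(2d + 1)|S| ≤ 2d|S|`.
  by_contra! hcon
  have hsum := (H.induce (S : Set V)).sum_degrees_eq_twice_card_edges
  have hE : (H.induce (S : Set V)).edgeFinset.card ≤ d * S.card := by
    rw [← SimpleGraph.coe_edgeFinset, Set.ncard_coe_finset] at h
    exact h
  have hdeg : ∀ x : (S : Set V), 2 * d + 1 ≤ (H.induce (S : Set V)).degree x := by
    rintro ⟨x, hx⟩
    refine (hcon x hx).trans_le ?_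
    rw [← SimpleGraph.card_neighborFinset_eq_degree, ← Finset.card_map (Function.Embedding.subtype _)]
    refine Finset.card_le_card ?_
    intro y hy
    rw [Finset.mem_filter] at hy
    rw [Finset.mem_map]
    exact ⟨⟨y, hy.1⟩, by rw [SimpleGraph.mem_neighborFinset]; exact hy.2, rfl⟩
  have hle := Finset.sum_le_sum (s := Finset.univ) fun x _ => hdeg x
  rw [hsum] at hle
  simp only [Finset.sum_const, Finset.card_univ, smul_eq_mul, Finset.coe_sort_coe,
    Fintype.card_coe] at hle
  have := hS.card_pos
  nlinarith

/-- In a `2d`-degenerate graph, few vertices have their neighbourhoods in cliques, provided that few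
have them in any given small set. -/
theorem card_le_of_degenerate [DecidableEq V] {H : SimpleGraph V} [DecidableRel H.Adj] {d K : ℕ}
    (N : V → Finset V) (S : Finset V)
    (hS : ∀ S' ⊆ S, S'.Nonempty → ∃ x ∈ S', (S'.filter fun y => H.Adj x y).card ≤ 2 * d)
    (W : Finset V) (hW : ∀ v ∈ W, (N v).Nonempty ∧ N v ⊆ S ∧
      ∀ x ∈ N v, ∀ y ∈ N v, x ≠ y → H.Adj x y)
    (hK : ∀ Q : Finset V, Q.card ≤ 2 * d + 1 → (W.filter fun v => N v ⊆ Q).card ≤ K) :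
    W.card ≤ K * S.card := by
  induction hn : S.card generalizing S W with
  | zero =>
    rw [Finset.card_eq_zero] at hn
    subst hn
    rw [mul_zero, Nat.le_zero, Finset.card_eq_zero, Finset.eq_empty_iff_forall_notMem]
    intro v hv
    obtain ⟨⟨x, hx⟩, h, -⟩ := hW v hv
    exact absurd (h hx) (Finset.notMem_empty x)
  | succ n ih =>
    obtain ⟨x, hx, hdeg⟩ := hS S subset_rfl (Finset.card_pos.1 (by omega))
    -- A clique through `x` lies in `x` together with its at most `2 * d` neighbours in `S`. The
    -- other cliques live in `S.erase x`, so each peeled vertex costs at most `K`.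
    have h1 : (W.filter fun v => x ∈ N v).card ≤ K := by
      refine (Finset.card_le_card ?_).trans
        (hK (insert x (S.filter fun y => H.Adj x y))
          ((Finset.card_insert_le _ _).trans (by omega)))
      intro v hv
      rw [Finset.mem_filter] at hv ⊢
      refine ⟨hv.1, fun y hy => ?_⟩
      obtain ⟨-, hs, hc⟩ := hW v hv.1
      rw [Finset.mem_insert, Finset.mem_filter]
      by_cases hyx : y = x
      · exact Or.inl hyx
      · exact Or.inr ⟨hs hy, hc x hv.2 y hy (Ne.symm hyx)⟩
    have h2 : (W.filter fun v => ¬ x ∈ N v).card ≤ K * n := by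
      refine ih (S.erase x) (fun S' hS' => hS S' (hS'.trans (Finset.erase_subset _ _)))
        (W.filter fun v => ¬ x ∈ N v) ?_ ?_ (by rw [Finset.card_erase_of_mem hx]; omega)
      · intro v hv
        rw [Finset.mem_filter] at hv
        obtain ⟨hne, hs, hc⟩ := hW v hv.1
        exact ⟨hne, Finset.subset_erase.2 ⟨hs, hv.2⟩, hc⟩
      · intro Q hQ
        refine (Finset.card_le_card ?_).trans (hK Q hQ)
        exact Finset.filter_subset_filter _ (Finset.filter_subset _ _)
    have := Finset.card_filter_add_card_filter_not (s := W) (fun v => x ∈ N v)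
    rw [mul_add, mul_one]
    omega

/-- Outside of a vertex cover `C` of a graph whose `1`-shallow minors are sparse there are only
`O(|C|)` vertices, provided that only few have their neighbourhood in any given small set. -/
theorem card_le_of_vertexCover [Fintype V] [DecidableEq V] {G : SimpleGraph V}
    [DecidableRel G.Adj] {d K : ℕ}
    (hd : ∀ (W : Type) [Fintype W] (H : SimpleGraph W), GraphClass.IsShallowMinor 1 H G →
        H.edgeSet.ncard ≤ d * Fintype.card W)
    (C J : Finset V) (hCJ : Disjoint J C)
    (hN : ∀ v ∈ J, (∃ x, G.Adj v x) ∧ ∀ x, G.Adj v x → x ∈ C)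
    (hK : ∀ Q : Finset V, Q.card ≤ 2 * d + 1 →
      (J.filter fun v => G.neighborFinset v ⊆ Q).card ≤ K) :
    J.card ≤ (d + K) * C.card := by
  classical
  -- Each vertex of a good set is assigned a pair of its neighbours, no pair twice.
  let Good : Finset V → Prop := fun M => M ⊆ J ∧ ∃ p q : V → V,
    (∀ v ∈ M, G.Adj v (p v) ∧ G.Adj v (q v) ∧ p v ≠ q v) ∧
    ∀ v ∈ M, ∀ v' ∈ M, s(p v, q v) = s(p v', q v') → v = v'
  obtain ⟨M, ⟨⟨hMJ, p, q, hM, hinj⟩, hmax⟩⟩ : ∃ M, Maximal Good M :=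
    Set.Finite.exists_maximal (Set.toFinite {M | Good M})
      ⟨∅, by simp, id, id, by simp, by simp⟩
  have hMC : Disjoint M C := hCJ.mono_left hMJ
  have hminor : ∀ S ⊆ C,
      ((pairGraph M p q).induce (S : Set V)).edgeSet.ncard ≤ d * S.card := by
    intro S hS
    have := hd _ _ (isShallowMinor_pairGraph (hMC.mono_right hS) (fun v hv => (hM v hv).1.symm)
      (fun v hv => (hM v hv).2.1))
    simpa using this
  have hMcard : M.card ≤ d * C.card := by
    refine le_trans ?_ (hminor C subset_rfl)
    have hpC : ∀ v ∈ M, p v ∈ C := fun v hv => (hN v (hMJ hv)).2 _ (hM v hv).1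
    have hqC : ∀ v ∈ M, q v ∈ C := fun v hv => (hN v (hMJ hv)).2 _ (hM v hv).2.1
    rw [← Set.ncard_coe_finset, ← Set.ncard_image_of_injective _
      (Sym2.map.injective (Subtype.val_injective (p := fun x => x ∈ (C : Set V))))]
    have himg : M.card = ((fun v => s(p v, q v)) '' (M : Set V)).ncard := by
      rw [Set.InjOn.ncard_image (fun v hv v' hv' h => hinj v hv v' hv' h), Set.ncard_coe_finset]
    rw [Set.ncard_coe_finset, himg]
    refine Set.ncard_le_ncard ?_ (Set.toFinite _)
    rintro _ ⟨v, hv, rfl⟩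
    refine ⟨s(⟨p v, hpC v hv⟩, ⟨q v, hqC v hv⟩), ?_, rfl⟩
    rw [SimpleGraph.mem_edgeSet]
    exact pairGraph_adj.2 ⟨(hM v hv).2.2, v, hv, rfl⟩
  -- By maximality: if the neighbours `x`, `y` of `v` were not joined, `v` could be added to `M`
  -- with this pair.
  have hclique : ∀ v ∈ J \ M, ∀ x, G.Adj v x → ∀ y, G.Adj v y → x ≠ y →
      (pairGraph M p q).Adj x y := by
    intro v hv x hx y hy hxy
    rw [Finset.mem_sdiff] at hv
    refine pairGraph_adj.2 ⟨hxy, ?_⟩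
    by_contra! hcon
    have hne : ∀ w ∈ M, w ≠ v := fun w hw h => hv.2 (h ▸ hw)
    have hgood : Good (insert v M) := by
      refine ⟨Finset.insert_subset hv.1 hMJ, Function.update p v x, Function.update q v y, ?_, ?_⟩
      · intro w hw
        rcases Finset.mem_insert.1 hw with rfl | hw
        · simpa using ⟨hx, hy, hxy⟩
        · simpa [hne w hw] using hM w hw
      · intro w hw w' hw' h
        rcases Finset.mem_insert.1 hw with rfl | hwM <;>
          rcases Finset.mem_insert.1 hw' with rfl | hwM'
        · rfl
        · simp only [Function.update_self, Function.update_of_ne (hne w' hwM')] at h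
          exact absurd h.symm (hcon w' hwM')
        · simp only [Function.update_self, Function.update_of_ne (hne w hwM)] at h
          exact absurd h (hcon w hwM)
        · simp only [Function.update_of_ne (hne w' hwM'), Function.update_of_ne (hne w hwM)] at h
          exact hinj w hwM w' hwM' h
    exact hv.2 (hmax hgood (Finset.subset_insert v M) (Finset.mem_insert_self v M))
  have hrest : (J \ M).card ≤ K * C.card := by
    refine card_le_of_degenerate (H := pairGraph M p q) (d := d) (fun v => G.neighborFinset v) C
      ?_ (J \ M) ?_ ?_
    · exact fun S hS hne => SimpleGraph.exists_card_adj_le hne (hminor S hS)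
    · intro v hv
      have hv' := hN v (Finset.mem_sdiff.1 hv).1
      refine ⟨?_, ?_, ?_⟩
      · obtain ⟨x, hx⟩ := hv'.1
        exact ⟨x, by rwa [SimpleGraph.mem_neighborFinset]⟩
      · intro x hx
        rw [SimpleGraph.mem_neighborFinset] at hx
        exact hv'.2 x hx
      · intro x hx y hy hxy
        rw [SimpleGraph.mem_neighborFinset] at hx hy
        exact hclique v hv x hx y hy hxy
    · intro Q hQ
      exact (Finset.card_le_card (Finset.filter_subset_filter _ Finset.sdiff_subset)).trans (hK Q hQ)
  have := Finset.card_sdiff_add_card_eq_card hMJ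
  rw [add_mul]
  omega

end ShallowMinor

/-! ## The kept vertices -/

section Kept

variable {n : ℕ} {E : Fin n → Fin n → Prop} {r : Fin n} {k : ℕ}

/-- The number of arcs at `v`. -/
noncomputable def totalDegree (E : Fin n → Fin n → Prop) (v : Fin n) : ℕ :=
  {w | E v w}.ncard + {w | E w v}.ncard

/-- `v` is the root or one of the first `totalDegree E v` vertices in its class of twins. -/
def IsKept (E : Fin n → Fin n → Prop) (r v : Fin n) : Prop :=
  v = r ∨ {u | u < v ∧ u ≠ r ∧ AreTwins E u v}.ncard < totalDegree E v

theorem AreTwins.totalDegree_eq {u v : Fin n} (h : AreTwins E u v) :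
    totalDegree E u = totalDegree E v := by
  have h1 : {w | E u w} = {w | E v w} := Set.ext fun w => (h w).1
  have h2 : {w | E w u} = {w | E w v} := Set.ext fun w => (h w).2
  rw [totalDegree, totalDegree, h1, h2]

/-- Let `u` be the least twin of `v` that is not kept. The non-root twins preceding `u` are all
kept, and there are at least `totalDegree E v` of them because `u` is not. -/
theorem exists_kept_twins {v : Fin n} (hv : ¬ IsKept E r v) :
    ∃ K : Finset (Fin n), (∀ u ∈ K, IsKept E r u ∧ u ≠ r ∧ AreTwins E u v) ∧
      totalDegree E v ≤ K.card := by
  classical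
  obtain ⟨u, ⟨⟨hu, htw⟩, hmin⟩⟩ : ∃ u, Minimal (fun u => ¬ IsKept E r u ∧ AreTwins E u v) u :=
    Set.Finite.exists_minimal (Set.toFinite {u | ¬ IsKept E r u ∧ AreTwins E u v})
      ⟨v, hv, AreTwins.refl v⟩
  refine ⟨{w | w < u ∧ w ≠ r ∧ AreTwins E w u}.toFinset, ?_, ?_⟩
  · intro w hw
    rw [Set.mem_toFinset] at hw
    obtain ⟨hwu, hwr, hw⟩ := hw
    refine ⟨?_, hwr, hw.trans htw⟩
    by_contra hcon
    exact absurd (hmin ⟨hcon, hw.trans htw⟩ hwu.le) (not_le.2 hwu)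
  · rw [← Set.ncard_eq_toFinset_card', ← htw.totalDegree_eq]
    exact not_lt.1 fun h => hu (Or.inr h)

/-- The number of preceding non-root twins increases strictly along `W` and stays below the degree
for kept vertices. -/
theorem card_kept_twins_le (v : Fin n) (W : Finset (Fin n))
    (hW : ∀ u ∈ W, IsKept E r u ∧ u ≠ r ∧ AreTwins E u v) : W.card ≤ totalDegree E v := by
  rw [← Finset.card_range (totalDegree E v)]
  refine Finset.card_le_card_of_injOn
    (fun u => {w | w < u ∧ w ≠ r ∧ AreTwins E w u}.ncard) ?_ ?_
  · intro u hu
    obtain ⟨hk, hur, htw⟩ := hW u hu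
    rw [Finset.mem_coe, Finset.mem_range, ← htw.totalDegree_eq]
    exact hk.resolve_left hur
  · have hlt : ∀ u ∈ W, ∀ u' ∈ W, u < u' →
        {w | w < u ∧ w ≠ r ∧ AreTwins E w u}.ncard <
          {w | w < u' ∧ w ≠ r ∧ AreTwins E w u'}.ncard := by
      intro u hu u' hu' h
      have htw : AreTwins E u u' := (hW u hu).2.2.trans (hW u' hu').2.2.symm
      refine Set.ncard_lt_ncard ?_ (Set.toFinite _)
      refine Set.ssubset_iff_of_subset ?_ |>.2 ⟨u, ⟨h, (hW u hu).2.1, htw⟩, ?_⟩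
      · exact fun w hw => ⟨hw.1.trans h, hw.2.1, hw.2.2.trans htw⟩
      · exact fun hcon => lt_irrefl _ hcon.1
    intro u hu u' hu' h
    rcases lt_trichotomy u u' with h' | h' | h'
    · exact absurd h (hlt u hu u' hu' h').ne
    · exact h'
    · exact absurd h.symm (hlt u' hu' u hu h').ne

/-- Ensures that a vertex that is not kept has a kept twin, below whose parent it can be reinserted.
-/
theorem totalDegree_pos (h : ∀ v, Relation.ReflTransGen E r v) {v : Fin n} (hv : v ≠ r) :
    0 < totalDegree E v := by
  obtain h' | ⟨u, -, hu⟩ := Relation.ReflTransGen.cases_tail (h v)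
  · exact absurd h' hv
  · have : 0 < {w | E w v}.ncard := (Set.ncard_pos (Set.toFinite _)).2 ⟨u, hu⟩
    rw [totalDegree]
    omega

/-- Removing all vertices that are not kept does not change the answer. -/
theorem hasInternalOutBranchingOn_kept_iff (h : ∀ v, Relation.ReflTransGen E r v) :
    HasInternalOutBranchingOn E {v | IsKept E r v} r k ↔
      HasInternalOutBranchingOn E Set.univ r k := by
  classical
  -- Vertices are removed one at a time; the twins justifying a removal are kept ones, so they are
  -- never removed themselves.
  have key : ∀ R : Finset (Fin n), (∀ v ∈ R, ¬ IsKept E r v) →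
      (HasInternalOutBranchingOn E (R : Set (Fin n))ᶜ r k ↔
        HasInternalOutBranchingOn E Set.univ r k) := by
    intro R
    induction R using Finset.induction_on with
    | empty => simp
    | insert v R hvR ih =>
      intro hR
      rw [← ih fun u hu => hR u (Finset.mem_insert_of_mem hu)]
      have hv := hR v (Finset.mem_insert_self v R)
      have hvr : v ≠ r := fun h => hv (Or.inl h)
      obtain ⟨K, hK, hcard⟩ := exists_kept_twins hv
      have hset : ((insert v R : Finset (Fin n)) : Set (Fin n))ᶜ =
          (R : Set (Fin n))ᶜ \ {v} := by
        ext x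
        simp only [Finset.coe_insert, Set.mem_compl_iff, Set.mem_insert_iff, Set.mem_sdiff,
          Set.mem_singleton_iff]
        tauto
      rw [hset]
      refine hasInternalOutBranchingOn_diff_singleton_iff K hvR hvr ?_ hcard
        (Finset.card_pos.1 ((totalDegree_pos h hvr).trans_le hcard))
      intro u hu
      obtain ⟨hk, hur, htw⟩ := hK u hu
      exact ⟨fun hu' => hR u (Finset.mem_insert_of_mem hu') hk, hur, fun h => hv (h ▸ hk), htw⟩
  have := key {v | ¬ IsKept E r v}.toFinset (by simp)
  rw [← this]
  have hset : {v | IsKept E r v} = (({v | ¬ IsKept E r v}.toFinset : Finset (Fin n)) : Set _)ᶜ := by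
    ext x
    simp
  rw [← hset]

/-- Few kept vertices have their neighbourhood in a given small set. -/
theorem card_kept_neighbors_subset_le {m : ℕ} (Q W : Finset (Fin n)) (hQ : Q.card ≤ m)
    (hW : ∀ v ∈ W, IsKept E r v ∧ v ≠ r ∧ ∀ w, E v w ∨ E w v → w ∈ Q) :
    W.card ≤ 2 * m * 4 ^ m := by
  classical
  -- There are at most `4 ^ m` pairs of an out- and an in-neighbourhood inside `Q`.
  have hQ4 : (Q.powerset ×ˢ Q.powerset).card ≤ 4 ^ m := by
    rw [Finset.card_product, Finset.card_powerset, ← mul_pow]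
    exact Nat.pow_le_pow_right (by norm_num) hQ
  refine le_trans ?_ (Nat.mul_le_mul_left _ hQ4)
  refine Finset.card_le_mul_card_image_of_maps_to
    (f := fun v => ({w | E v w}.toFinset, {w | E w v}.toFinset)) ?_ _ ?_
  · intro v hv
    simp only [Finset.mem_product, Finset.mem_powerset]
    constructor
    · intro w hw
      exact (hW v hv).2.2 w (Or.inl (by simpa using hw))
    · intro w hw
      exact (hW v hv).2.2 w (Or.inr (by simpa using hw))
  · rintro ⟨A, B⟩ hAB
    rcases Finset.eq_empty_or_nonempty (W.filter fun v =>
      ({w | E v w}.toFinset, {w | E w v}.toFinset) = (A, B)) with h0 | ⟨v, hv⟩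
    · rw [h0]
      simp
    · have hdata : ∀ u ∈ W.filter fun v => ({w | E v w}.toFinset, {w | E w v}.toFinset) = (A, B),
          u ∈ W ∧ {w | E u w} = (A : Set (Fin n)) ∧ {w | E w u} = (B : Set (Fin n)) := by
        intro u hu
        rw [Finset.mem_filter, Prod.mk.injEq] at hu
        obtain ⟨h1, h2, h3⟩ := hu
        exact ⟨h1, by rw [← h2]; simp, by rw [← h3]; simp⟩
      -- A fibre lies in one twin class, so it has at most `|A| + |B| ≤ 2m` kept vertices.
      refine (card_kept_twins_le (E := E) (r := r) v _ ?_).trans ?_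
      · intro u hu
        obtain ⟨h1, h2, h3⟩ := hdata u hu
        obtain ⟨-, h2', h3'⟩ := hdata v hv
        refine ⟨(hW u h1).1, (hW u h1).2.1, fun w => ⟨?_, ?_⟩⟩
        · exact Set.ext_iff.1 (h2.trans h2'.symm) w
        · exact Set.ext_iff.1 (h3.trans h3'.symm) w
      · obtain ⟨-, h2', h3'⟩ := hdata v hv
        rw [totalDegree, h2', h3', Set.ncard_coe_finset, Set.ncard_coe_finset]
        rw [Finset.mem_product, Finset.mem_powerset, Finset.mem_powerset] at hAB
        have h1 := Finset.card_le_card hAB.1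
        have h2 := Finset.card_le_card hAB.2
        dsimp only at h1 h2
        omega

/-- The kernel of a NO-instance is small. -/
theorem card_kept_le {d : ℕ} {D : Digraph (Fin n)}
    (hd : ∀ (W : Type) [Fintype W] (H : SimpleGraph W),
      GraphClass.IsShallowMinor 1 H D.toSimpleGraphInclusive →
        H.edgeSet.ncard ≤ d * Fintype.card W)
    (h : ∀ v, Relation.ReflTransGen D.ProperAdj r v)
    (hno : ¬ HasInternalOutBranchingOn D.ProperAdj Set.univ r k) :
    {v | IsKept D.ProperAdj r v}.ncard ≤
      (1 + d + 2 * (2 * d + 1) * 4 ^ (2 * d + 1)) * 2 * k := by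
  classical
  have hadj : ∀ u v, D.toSimpleGraphInclusive.Adj u v ↔ D.ProperAdj u v ∨ D.ProperAdj v u := by
    intro u v
    rw [Digraph.toSimpleGraphInclusive, SimpleGraph.fromRel_adj, Digraph.ProperAdj,
      Digraph.ProperAdj, ne_comm (a := v)]
    tauto
  obtain ⟨C, hrC, hC, hcover⟩ := exists_vertexCover h hno
  let J : Finset (Fin n) := Finset.univ.filter fun v => IsKept D.ProperAdj r v ∧ v ∉ C
  have hJ : ∀ v ∈ J, IsKept D.ProperAdj r v ∧ v ∉ C := fun v hv => (Finset.mem_filter.1 hv).2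
  have hne : ∀ v ∈ J, v ≠ r := fun v hv hvr => (hJ v hv).2 (hvr ▸ hrC)
  have hJcard : J.card ≤ (d + 2 * (2 * d + 1) * 4 ^ (2 * d + 1)) * C.card := by
    refine card_le_of_vertexCover hd C J ?_ ?_ ?_
    · rw [Finset.disjoint_left]
      exact fun v hv => (hJ v hv).2
    · intro v hv
      constructor
      · obtain h' | ⟨u, -, hu⟩ := Relation.ReflTransGen.cases_tail (h v)
        · exact absurd h' (hne v hv)
        · exact ⟨u, (hadj v u).2 (Or.inr hu)⟩
      · intro x hx
        by_contra hxC
        rcases (hadj v x).1 hx with h' | h'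
        · exact hcover v x (hJ v hv).2 hxC h'.2 h'
        · exact hcover x v hxC (hJ v hv).2 h'.2 h'
    · intro Q hQ
      refine card_kept_neighbors_subset_le (E := D.ProperAdj) (r := r) Q _ hQ ?_
      intro v hv
      rw [Finset.mem_filter] at hv
      refine ⟨(hJ v hv.1).1, hne v hv.1, fun w hw => hv.2 ?_⟩
      rw [SimpleGraph.mem_neighborFinset]
      exact (hadj v w).2 hw
  have hsub : {v | IsKept D.ProperAdj r v}.ncard ≤ (C ∪ J).card := by
    rw [Set.ncard_eq_toFinset_card']
    refine Finset.card_le_card fun v hv => ?_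
    rw [Set.mem_toFinset] at hv
    rw [Finset.mem_union]
    by_cases hvC : v ∈ C
    · exact Or.inl hvC
    · exact Or.inr (Finset.mem_filter.2 ⟨Finset.mem_univ _, hv, hvC⟩)
  calc _ ≤ C.card + J.card := hsub.trans (Finset.card_union_le _ _)
    _ ≤ (1 + d + 2 * (2 * d + 1) * 4 ^ (2 * d + 1)) * C.card := by
      rw [add_assoc, add_mul, one_mul]
      omega
    _ ≤ _ := by
      rw [mul_assoc _ 2 k]
      exact Nat.mul_le_mul_left _ hC

end Kept

/-! ## Reasoning about random access machine programs -/

namespace Ram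

/-- Started on `s`, the program `p` halts within `T` steps in a store satisfying `Q`. -/
def Exec (p : Prog) (T : ℕ) (s : Store) (Q : Store → Prop) : Prop :=
  ∃ t s', Runs p s t s' ∧ t ≤ T ∧ Q s'

/-- `s'` agrees with `s` except for the registers in `R` and the arrays in `A`. -/
structure Frame (R A : Finset ℕ) (s s' : Store) : Prop where
  reg : ∀ i, i ∉ R → s'.reg i = s.reg i
  arr : ∀ a, a ∉ A → s'.arr a = s.arr a

/-- `p` is executed for the values of register `r` from `0` up to the value of register `0`. -/
def Prog.forLoop (r : ℕ) (p : Prog) : Prog :=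
  .seq (.assign r (.const 0))
    (.loop (.lt (.reg r) (.reg 0)) (.seq p (.assign r (.add (.reg r) (.const 1)))))

/-- Register `acc` becomes the sum of the values of `e`, computed with the help of `q`, for the values
of register `r` from `0` up to the value of register `0`. -/
def Prog.sumLoop (r acc : ℕ) (q : Prog) (e : Expr) : Prog :=
  .seq (.assign acc (.const 0)) (.forLoop r (.seq q (.assign acc (.add (.reg acc) e))))

/-- The cells of array `a` become the values of `e`, as a function of registers `4` and `5`. -/
def Prog.fill (a : ℕ) (e : Expr) : Prog :=
  .forLoop 4 (.forLoop 5 (.write a (.reg 4) (.reg 5) e))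

/-- `c` times the value of `e`. -/
def Expr.nsmul (e : Expr) : ℕ → Expr
  | 0 => .const 0
  | c + 1 => .add (e.nsmul c) e

/-- The absolute value of the difference. -/
def Expr.dist (e f : Expr) : Expr := .add (.sub e f) (.sub f e)

theorem Expr.eval_nsmul (e : Expr) (c : ℕ) (s : Store) : (e.nsmul c).eval s = c * e.eval s := by
  induction c with
  | zero => simp [Expr.nsmul, Expr.eval]
  | succ c ih => rw [Expr.nsmul, Expr.eval, ih, Nat.succ_mul]

@[simp] theorem Store.setReg_reg (s : Store) (i x j : ℕ) :
    (s.setReg i x).reg j = if j = i then x else s.reg j := by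
  simp [Store.setReg, Function.update_apply]

@[simp] theorem Store.setReg_arr (s : Store) (i x : ℕ) : (s.setReg i x).arr = s.arr := rfl

@[simp] theorem Store.setCell_reg (s : Store) (a i j x : ℕ) : (s.setCell a i j x).reg = s.reg := rfl

@[simp] theorem Store.setCell_arr (s : Store) (a i j x a' i' j' : ℕ) :
    (s.setCell a i j x).arr a' i' j' =
      if a' = a ∧ i' = i ∧ j' = j then x else s.arr a' i' j' := rfl

section Frame

variable {R R' A A' : Finset ℕ} {s s' s'' : Store}

theorem Frame.refl (s : Store) : Frame R A s s := ⟨fun _ _ => rfl, fun _ _ => rfl⟩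

theorem Frame.trans (h : Frame R A s s') (h' : Frame R A s' s'') : Frame R A s s'' :=
  ⟨fun i hi => (h'.reg i hi).trans (h.reg i hi), fun a ha => (h'.arr a ha).trans (h.arr a ha)⟩

theorem Frame.mono (h : Frame R A s s') (hR : R ⊆ R') (hA : A ⊆ A') : Frame R' A' s s' :=
  ⟨fun i hi => h.reg i fun h => hi (hR h), fun a ha => h.arr a fun h => ha (hA h)⟩

theorem Frame.setReg (h : Frame R A s s') {i : ℕ} (hi : i ∈ R) (x : ℕ) :
    Frame R A s (s'.setReg i x) :=
  ⟨fun j hj => by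
    rw [Store.setReg_reg, if_neg (by rintro rfl; exact hj hi), h.reg j hj], h.arr⟩

theorem Frame.setCell (h : Frame R A s s') {a : ℕ} (ha : a ∈ A) (i j x : ℕ) :
    Frame R A s (s'.setCell a i j x) :=
  ⟨h.reg, fun b hb => by
    rw [← h.arr b hb]
    funext i' j'
    rw [Store.setCell_arr, if_neg]
    rintro ⟨rfl, -⟩
    exact hb ha⟩

end Frame

section Exec

variable {p q : Prog} {T T' : ℕ} {s : Store} {Q Q' : Store → Prop}

theorem Exec.weaken (h : Exec p T s Q) (hT : T ≤ T') (hQ : ∀ s', Q s' → Q' s') :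
    Exec p T' s Q' := by
  obtain ⟨t, s', hr, ht, hq⟩ := h
  exact ⟨t, s', hr, ht.trans hT, hQ s' hq⟩

theorem Exec.skip (h : Q s) : Exec .skip 1 s Q := ⟨_, _, .skip s, le_rfl, h⟩

theorem Exec.assign {i : ℕ} {e : Expr} (h : Q (s.setReg i (e.eval s))) :
    Exec (.assign i e) (e.cost + 1) s Q := ⟨_, _, .assign i e s, le_rfl, h⟩

theorem Exec.write {a : ℕ} {i j e : Expr}
    (h : Q (s.setCell a (i.eval s) (j.eval s) (e.eval s))) :
    Exec (.write a i j e) (i.cost + j.cost + e.cost + 1) s Q :=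
  ⟨_, _, .write a i j e s, le_rfl, h⟩

theorem Exec.seq (h : Exec p T s Q') (h' : ∀ s', Q' s' → Exec q T' s' Q) :
    Exec (.seq p q) (T + T') s Q := by
  obtain ⟨t, s', hr, ht, hq⟩ := h
  obtain ⟨t', s'', hr', ht', hq'⟩ := h' s' hq
  exact ⟨_, _, .seq hr hr', add_le_add ht ht', hq'⟩

theorem Exec.cond {b : Test} (h : b.Holds s → Exec p T s Q) (h' : ¬ b.Holds s → Exec q T s Q) :
    Exec (.cond b p q) (b.cost + T) s Q := by
  by_cases hb : b.Holds s
  · obtain ⟨t, s', hr, ht, hq⟩ := h hb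
    exact ⟨_, _, .cond_true hb hr, Nat.add_le_add_left ht _, hq⟩
  · obtain ⟨t, s', hr, ht, hq⟩ := h' hb
    exact ⟨_, _, .cond_false hb hr, Nat.add_le_add_left ht _, hq⟩

/-- Besides `T`, a round costs `3` for the test and `4` for the increment; the final `5` pays for
the initialization and the failing test. The body leaves registers `0` and `r` alone, and the
invariant is required after the increment. -/
theorem Exec.forLoop {r : ℕ} {R A : Finset ℕ} (Inv : ℕ → Store → Prop) (hr : r ≠ 0) (hrR : r ∉ R)
    (hR : 0 ∉ R) (hinit : Inv 0 (s.setReg r 0))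
    (hstep : ∀ j < s.reg 0, ∀ s₁, Frame (insert r R) A s s₁ → s₁.reg r = j → Inv j s₁ →
      Exec p T s₁ fun s₂ => Frame R A s₁ s₂ ∧ Inv (j + 1) (s₂.setReg r (j + 1))) :
    Exec (.forLoop r p) (s.reg 0 * (T + 7) + 5) s
      fun s' => Frame (insert r R) A s s' ∧ Inv (s.reg 0) s' := by
  have key : ∀ m j, j + m = s.reg 0 → ∀ s₁, Frame (insert r R) A s s₁ → s₁.reg r = j →
      Inv j s₁ → Exec (.loop (.lt (.reg r) (.reg 0)) (.seq p (.assign r (.add (.reg r) (.const 1)))))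
        (m * (T + 7) + 3) s₁ fun s' => Frame (insert r R) A s s' ∧ Inv (s.reg 0) s' := by
    intro m
    induction m with
    | zero =>
      intro j hj s₁ hf hrj hinv
      have h0 : s₁.reg 0 = s.reg 0 := hf.reg 0 (by simp [hR, hr.symm])
      refine ⟨_, _, .loop_false ?_, ?_, hf, ?_⟩
      · simp only [Test.Holds, Expr.eval]
        omega
      · simp [Test.cost, Expr.cost]
      · rwa [← hj]
    | succ m ih =>
      intro j hj s₁ hf hrj hinv
      have h0 : s₁.reg 0 = s.reg 0 := hf.reg 0 (by simp [hR, hr.symm])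
      obtain ⟨t, s₂, hrun, ht, hf', hinv'⟩ := hstep j (by omega) s₁ hf hrj hinv
      have hrj' : s₂.reg r = j := (hf'.reg r hrR).trans hrj
      have hf'' : Frame (insert r R) A s (s₂.setReg r (j + 1)) :=
        (hf.trans (hf'.mono (Finset.subset_insert _ _) subset_rfl)).setReg
          (Finset.mem_insert_self _ _) _
      obtain ⟨t', s₃, hrun', ht', hq⟩ := ih (j + 1) (by omega) _ hf'' (by simp) hinv'
      have hassign : Runs (.assign r (.add (.reg r) (.const 1))) s₂ 4 (s₂.setReg r (j + 1)) := by
        have := Runs.assign r (.add (.reg r) (.const 1)) s₂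
        simpa [Expr.eval, Expr.cost, hrj'] using this
      refine ⟨_, s₃, .loop_true ?_ (.seq hrun hassign) hrun', ?_, hq⟩
      · simp only [Test.Holds, Expr.eval]
        omega
      · simp only [Test.cost, Expr.cost]
        rw [add_mul, one_mul]
        omega
  have h0 := key (s.reg 0) 0 (by omega) (s.setReg r 0)
    ((Frame.refl s).setReg (Finset.mem_insert_self _ _) _) (by simp) hinit
  obtain ⟨t, s', hrun, ht, hq⟩ := h0
  refine ⟨_, s', .seq (.assign r (.const 0) s) hrun, ?_, hq⟩
  simp only [Expr.cost]
  omega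

theorem Exec.sumLoop {r acc : ℕ} {e : Expr} {R A : Finset ℕ} (g : ℕ → ℕ) (hr : r ≠ 0)
    (hacc : acc ≠ 0) (hracc : r ≠ acc) (hrR : r ∉ R) (haccR : acc ∉ R) (hR : 0 ∉ R)
    (hstep : ∀ j < s.reg 0, ∀ s₁, Frame (insert r (insert acc R)) A s s₁ → s₁.reg r = j →
      Exec q T s₁ fun s₂ => Frame R A s₁ s₂ ∧ e.eval s₂ = g j) :
    Exec (.sumLoop r acc q e) (s.reg 0 * (T + e.cost + 10) + 7) s
      fun s' => Frame (insert r (insert acc R)) A s s' ∧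
        s'.reg acc = ∑ j ∈ Finset.range (s.reg 0), g j := by
  have h0 : (s.setReg acc 0).reg 0 = s.reg 0 := by simp [hacc.symm]
  have hf0 : Frame (insert r (insert acc R)) A s (s.setReg acc 0) :=
    (Frame.refl s).setReg (by simp) _
  refine Exec.weaken (Exec.seq (Exec.assign (Q := fun s' => s' = s.setReg acc 0) rfl) fun s' hs' => ?_)
    (T := 2 + (s.reg 0 * ((T + (e.cost + 3)) + 7) + 5)) (by ring_nf; omega) fun s' h => h
  subst hs'
  refine Exec.weaken (T := (s.setReg acc 0).reg 0 * ((T + (e.cost + 3)) + 7) + 5)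
    (Exec.forLoop (R := insert acc R) (A := A)
      (fun j s' => s'.reg acc = ∑ i ∈ Finset.range j, g i) hr (by simp [hracc, hrR])
      (by simp [hacc.symm, hR]) ?_ ?_) (by rw [h0]) ?_
  · simp
  · intro j hj s₁ hf hrj hinv
    refine Exec.weaken (Exec.seq (hstep j (by rwa [h0] at hj) s₁ (hf0.trans hf) hrj) fun s₂ hs₂ =>
      Exec.assign (Q := fun s' => Frame (insert acc R) A s₁ s' ∧
        (s'.setReg r (j + 1)).reg acc = ∑ i ∈ Finset.range (j + 1), g i) ?_) ?_ fun _ h => h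
    · obtain ⟨hf₂, he⟩ := hs₂
      refine ⟨(hf₂.mono (Finset.subset_insert _ _) subset_rfl).setReg
        (Finset.mem_insert_self _ _) _, ?_⟩
      simp [hracc.symm, Expr.eval, he, hf₂.reg acc haccR, hinv, Finset.sum_range_succ]
    · simp only [Expr.cost]
      omega
  · rintro s' ⟨hf, hs'⟩
    rw [h0] at hs'
    exact ⟨hf0.trans hf, hs'⟩

/-- The value of `e` must be insensitive to changes in array `a`, since earlier writes are already
visible. -/
theorem Exec.fill {a : ℕ} {e : Expr} (g : ℕ → ℕ → ℕ)
    (hg : ∀ i < s.reg 0, ∀ j < s.reg 0, ∀ s₁, Frame {4, 5} {a} s s₁ → s₁.reg 4 = i →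
      s₁.reg 5 = j → e.eval s₁ = g i j) :
    Exec (.fill a e) (s.reg 0 * (s.reg 0 * (e.cost + 10) + 12) + 5) s
      fun s' => Frame {4, 5} {a} s s' ∧
        ∀ i < s.reg 0, ∀ j < s.reg 0, s'.arr a i j = g i j := by
  refine Exec.weaken (Exec.forLoop (R := {5}) (A := {a})
      (T := s.reg 0 * (e.cost + 10) + 5)
      (fun i s' => ∀ i' < i, ∀ j < s.reg 0, s'.arr a i' j = g i' j) (by simp) (by simp) (by simp)
      ?_ ?_) le_rfl fun s' h => h
  · simp
  · intro i hi s₁ hf h4 hinv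
    have h0 : s₁.reg 0 = s.reg 0 := hf.reg 0 (by simp)
    refine Exec.weaken (Exec.forLoop (R := ∅) (A := {a})
      (T := e.cost + 3)
      (fun j s' => (∀ i' < i, ∀ j < s.reg 0, s'.arr a i' j = g i' j) ∧
        ∀ j' < j, s'.arr a i j' = g i j') (by simp) (by simp) (by simp)
      ?_ ?_) (le_of_eq (by rw [h0])) ?_
    · simpa using hinv
    · rintro j hj s₂ hf₂ h5 ⟨hinv₁, hinv₂⟩
      have h4' : s₂.reg 4 = i := (hf₂.reg 4 (by simp)).trans h4
      have he : e.eval s₂ = g i j := by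
        refine hg i hi j (by rwa [h0] at hj) s₂ ?_ h4' h5
        refine hf.trans (hf₂.mono ?_ subset_rfl)
        simp
      refine Exec.weaken (Exec.write (Q := fun s' => Frame ∅ {a} s₂ s' ∧
        (∀ i' < i, ∀ j < s.reg 0, s'.arr a i' j = g i' j) ∧ ∀ j' < j + 1, s'.arr a i j' = g i j')
        ?_) (by simp only [Expr.cost]; omega) fun s' h => h
      refine ⟨(Frame.refl _).setCell (Finset.mem_singleton_self _) _ _ _, ?_, ?_⟩
      · intro i' hi' j' hj'
        simp only [Expr.eval, Store.setCell_arr, h4', h5, true_and]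
        rw [if_neg (by omega)]
        exact hinv₁ i' hi' j' hj'
      · intro j' hj'
        simp only [Expr.eval, Store.setCell_arr, h4', h5, true_and]
        split_ifs with h
        · rw [he, h]
        · exact hinv₂ j' (by omega)
    · rintro s₂ ⟨hf₂, h₁, h₂⟩
      refine ⟨by simpa using hf₂, ?_⟩
      intro i' hi' j hj
      rcases Nat.lt_succ_iff_lt_or_eq.1 hi' with h | rfl
      · exact h₁ i' h j hj
      · exact h₂ j (by rwa [h0])

end Exec

theorem Exec.mono_time {p : Prog} {T T' : ℕ} {s : Store} {Q : Store → Prop} (h : Exec p T s Q)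
    (hT : T ≤ T') : Exec p T' s Q := h.weaken hT fun _ h => h

/-! ## Reachability -/

section Reach

/-- The vertices marked in array `2`. -/
def Store.marked (s : Store) (n : ℕ) : Finset ℕ := (Finset.range n).filter fun v => 0 < s.arr 2 v 0

/-- The arcs of the digraph given by the matrix `M`. -/
def matrixAdj (n : ℕ) (M : ℕ → ℕ → ℕ) (u v : ℕ) : Prop := u < n ∧ v < n ∧ 0 < M u v

/-- The successors of all marked vertices are marked. -/
def Prog.markSuccessors : Prog :=
  .forLoop 4 (.forLoop 5 (.cond
    (.and (.lt (.const 0) (.cell 2 (.reg 4) (.const 0)))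
      (.lt (.const 0) (.cell 1 (.reg 4) (.reg 5))))
    (.write 2 (.reg 5) (.const 0) (.const 1)) .skip))

/-- All vertices reachable from the root are marked. -/
def Prog.markReachable : Prog :=
  .seq (.write 2 (.reg 1) (.const 0) (.const 1)) (.forLoop 6 .markSuccessors)

theorem Store.mem_marked {s : Store} {n v : ℕ} : v ∈ s.marked n ↔ v < n ∧ 0 < s.arr 2 v 0 := by
  simp [Store.marked]

/-- The pass works in place, so new marks may spread at once. Hence only bounds are claimed: marks
stay within any `P` closed under arcs, none is lost, and successors of the initial marks are marked.
-/
theorem exec_markSuccessors (s : Store) (P : ℕ → Prop)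
    (hP : ∀ u v, P u → matrixAdj (s.reg 0) (s.arr 1) u v → P v)
    (hs : ∀ v ∈ s.marked (s.reg 0), P v) :
    Exec .markSuccessors (s.reg 0 * (s.reg 0 * 22 + 12) + 5) s fun s' => Frame {4, 5} {2} s s' ∧
      (∀ v ∈ s'.marked (s.reg 0), P v) ∧ s.marked (s.reg 0) ⊆ s'.marked (s.reg 0) ∧
      ∀ u ∈ s.marked (s.reg 0), ∀ v, matrixAdj (s.reg 0) (s.arr 1) u v →
        v ∈ s'.marked (s.reg 0) := by
  refine Exec.weaken (Exec.forLoop (R := {5}) (A := {2}) (T := s.reg 0 * 22 + 5)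
    (fun i s' => (∀ v ∈ s'.marked (s.reg 0), P v) ∧ s.marked (s.reg 0) ⊆ s'.marked (s.reg 0) ∧
      ∀ u ∈ s.marked (s.reg 0), u < i → ∀ v, matrixAdj (s.reg 0) (s.arr 1) u v →
        v ∈ s'.marked (s.reg 0)) (by simp) (by simp) (by simp) ?_ ?_) le_rfl ?_
  · exact ⟨hs, subset_rfl, fun u _ h => absurd h (Nat.not_lt_zero u)⟩
  · rintro i hi s₁ hf h4 ⟨hP₁, hsub₁, hsucc₁⟩
    have h0 : s₁.reg 0 = s.reg 0 := hf.reg 0 (by simp)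
    refine Exec.weaken (Exec.forLoop (R := ∅) (A := {2}) (T := 15)
      (fun j s' => (∀ v ∈ s'.marked (s.reg 0), P v) ∧ s₁.marked (s.reg 0) ⊆ s'.marked (s.reg 0) ∧
        (i ∈ s.marked (s.reg 0) → ∀ v < j, matrixAdj (s.reg 0) (s.arr 1) i v →
          v ∈ s'.marked (s.reg 0))) (by simp) (by simp) (by simp) ?_ ?_) (le_of_eq (by rw [h0])) ?_
    · exact ⟨hP₁, subset_rfl, fun _ v h => absurd h (Nat.not_lt_zero v)⟩
    · rintro j hj s₂ hf₂ h5 ⟨hP₂, hsub₂, hsucc₂⟩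
      rw [h0] at hj
      have h4' : s₂.reg 4 = i := (hf₂.reg 4 (by simp)).trans h4
      have hM : s₂.arr 1 = s.arr 1 := (hf₂.arr 1 (by simp)).trans (hf.arr 1 (by simp))
      refine Exec.weaken (Exec.cond (T := 4) (fun hb => ?_) (fun hb => ?_)) ?_ fun s' h => h
      · refine Exec.write ?_
        simp only [Test.Holds, Expr.eval, h4', h5, hM] at hb
        have hmem : ∀ v, v ∈ (s₂.setCell 2 j 0 1).marked (s.reg 0) ↔
            v = j ∨ v ∈ s₂.marked (s.reg 0) := by
          intro v
          simp only [Store.mem_marked, Store.setCell_arr, true_and, and_true]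
          split_ifs with h
          · simp [h, hj]
          · simp [h]
        simp only [Expr.eval, h5]
        refine ⟨(Frame.refl _).setCell (Finset.mem_singleton_self _) _ _ _, ?_, ?_, ?_⟩
        · intro v hv
          rcases (hmem v).1 hv with rfl | hv
          · exact hP i v (hP₂ i (Store.mem_marked.2 ⟨hi, hb.1⟩)) ⟨hi, hj, hb.2⟩
          · exact hP₂ v hv
        · exact fun v hv => (hmem v).2 (Or.inr (hsub₂ hv))
        · intro hi' v hv hiv
          rcases Nat.lt_succ_iff_lt_or_eq.1 hv with h | h
          · exact (hmem v).2 (Or.inr (hsucc₂ hi' v h hiv))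
          · exact (hmem v).2 (Or.inl h)
      · refine Exec.weaken (Exec.skip ?_) (by norm_num) fun s' h => h
        simp only [Test.Holds, Expr.eval, h4', h5, hM] at hb
        refine ⟨Frame.refl _, hP₂, hsub₂, ?_⟩
        intro hi' v hv hiv
        rcases Nat.lt_succ_iff_lt_or_eq.1 hv with h | rfl
        · exact hsucc₂ hi' v h hiv
        · exact absurd ⟨(Store.mem_marked.1 (hsub₂ (hsub₁ hi'))).2, hiv.2.2⟩ hb
      · simp [Test.cost, Expr.cost]
    · rintro s₂ ⟨hf₂, hP₂, hsub₂, hsucc₂⟩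
      refine ⟨by simpa using hf₂, hP₂, hsub₁.trans hsub₂, ?_⟩
      intro u hu hui v huv
      rcases Nat.lt_succ_iff_lt_or_eq.1 hui with h | rfl
      · exact hsub₂ (hsucc₁ u hu h v huv)
      · exact hsucc₂ hu v (by rw [h0]; exact huv.2.1) huv
  · rintro s' ⟨hf, hP', hsub, hsucc⟩
    exact ⟨hf, hP', hsub, fun u hu v huv => hsucc u hu huv.1 v huv⟩

theorem exec_markReachable (s : Store) (hr : s.reg 1 < s.reg 0) (h2 : ∀ v, s.arr 2 v 0 = 0) :
    Exec .markReachable (s.reg 0 * (s.reg 0 * (s.reg 0 * 22 + 12) + 12) + 9) s fun s' =>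
      Frame {4, 5, 6} {2} s s' ∧ ∀ v, v ∈ s'.marked (s.reg 0) ↔
        Relation.ReflTransGen (matrixAdj (s.reg 0) (s.arr 1)) (s.reg 1) v := by
  set n := s.reg 0 with hn
  set Reach := Relation.ReflTransGen (matrixAdj n (s.arr 1)) (s.reg 1) with hReach
  refine Exec.mono_time (Exec.seq (Exec.write (Q := fun s' => s' = s.setCell 2 (s.reg 1) 0 1) rfl)
    fun s₀ hs₀ => Exec.weaken (T' := n * (n * (n * 22 + 12) + 12) + 5)
      (Exec.forLoop (r := 6) (R := {4, 5}) (A := {2})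
      (T := n * (n * 22 + 12) + 5)
      -- A round that adds no mark proves the marked set closed; so `t` rounds give `t + 1` marks or
      -- all reachable vertices, and `n` rounds suffice.
      (fun t s' => (∀ v ∈ s'.marked n, Reach v) ∧ s.reg 1 ∈ s'.marked n ∧
        (t + 1 ≤ (s'.marked n).card ∨ ∀ v, Reach v → v ∈ s'.marked n))
      (by simp) (by simp) (by simp) ?_ ?_) ?_ ?_) (by simp only [Expr.cost]; omega)
  · have h0 : s₀.marked n = {s.reg 1} := by
      subst hs₀
      ext v
      simp only [Store.mem_marked, Store.setCell_arr, true_and, and_true, Finset.mem_singleton, h2]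
      split_ifs with h
      · simp [h, hr]
      · simp [h]
    have h0' : (s₀.setReg 6 0).marked n = {s.reg 1} := h0
    rw [h0']
    simp only [Finset.mem_singleton, forall_eq, true_and, Finset.card_singleton]
    exact ⟨.refl, Or.inl le_rfl⟩
  · rintro t ht s₁ hf h6 ⟨hP, hroot, hcard⟩
    have h0 : s₁.reg 0 = n := by
      rw [hf.reg 0 (by simp), hs₀]
      rfl
    have h1 : s₁.arr 1 = s.arr 1 := by
      rw [hf.arr 1 (by simp), hs₀]
      funext i j
      simp
    have hex := exec_markSuccessors s₁ Reach
    rw [h0, h1] at hex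
    refine Exec.weaken (hex (fun u v hu huv => hu.tail huv) hP) le_rfl ?_
    rintro s₂ ⟨hf₂, hP₂, hsub, hsucc⟩
    refine ⟨hf₂, hP₂, hsub hroot, ?_⟩
    change t + 1 + 1 ≤ (s₂.marked n).card ∨ ∀ v, Reach v → v ∈ s₂.marked n
    rcases hcard with hcard | hcard
    · rcases hsub.eq_or_ssubset with h | h
      · right
        intro v hv
        rw [← h] at hsucc ⊢
        induction hv with
        | refl => exact hroot
        | tail _ huv ih => exact hsucc _ ih _ huv
      · left
        have := Finset.card_lt_card h
        omega
    · exact Or.inr fun v hv => hsub (hcard v hv)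
  · have h0 : s₀.reg 0 = n := by rw [hs₀]; rfl
    rw [h0]
  · rintro s' ⟨hf, hP, -, hcard⟩
    have h0 : s₀.reg 0 = n := by rw [hs₀]; rfl
    refine ⟨?_, fun v => ⟨hP v, ?_⟩⟩
    · refine Frame.trans (s' := s₀) ?_ (hf.mono (by decide) subset_rfl)
      rw [hs₀]
      exact (Frame.refl _).setCell (Finset.mem_singleton_self _) _ _ _
    · rcases hcard with hcard | hcard
      · have : (s'.marked n).card ≤ n := by
          refine (Finset.card_le_card (Finset.filter_subset _ _)).trans ?_
          simp
        omega
      · exact hcard v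

end Reach

/-! ## Selection of the kept vertices -/

section Select

/-- The number of arcs at `v`. -/
def matrixDegree (n : ℕ) (M : ℕ → ℕ → ℕ) (v : ℕ) : ℕ := ∑ w ∈ Finset.range n, (M v w + M w v)

/-- The total difference between the rows and between the columns of `u` and `v`. -/
def matrixDist (n : ℕ) (M : ℕ → ℕ → ℕ) (u v : ℕ) : ℕ :=
  ∑ w ∈ Finset.range n, (((M u w - M v w) + (M v w - M u w)) + ((M w u - M w v) + (M w v - M w u)))

/-- The number of twins of `v` that precede it and differ from `r`. -/
def matrixTwins (n : ℕ) (M : ℕ → ℕ → ℕ) (r v : ℕ) : ℕ :=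
  ∑ u ∈ Finset.range n,
    (((1 - matrixDist n M u v) - (1 - (v - u))) - (1 - ((u - r) + (r - u))))

/-- `v` is to be kept. -/
def matrixKept (n : ℕ) (M : ℕ → ℕ → ℕ) (r v : ℕ) : Prop :=
  v = r ∨ matrixTwins n M r v < matrixDegree n M v

instance (n : ℕ) (M : ℕ → ℕ → ℕ) (r : ℕ) : DecidablePred (matrixKept n M r) :=
  fun v => inferInstanceAs (Decidable (v = r ∨ matrixTwins n M r v < matrixDegree n M v))

/-- Register `9` becomes the number of arcs at the vertex in register `4`, and register `10` the
number of its twins that precede it. -/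
def Prog.countTwins : Prog :=
  .seq (.sumLoop 5 9 .skip (.add (.cell 1 (.reg 4) (.reg 5)) (.cell 1 (.reg 5) (.reg 4))))
    (.sumLoop 5 10
      (.sumLoop 6 11 .skip
        (.add (.dist (.cell 1 (.reg 5) (.reg 6)) (.cell 1 (.reg 4) (.reg 6)))
          (.dist (.cell 1 (.reg 6) (.reg 5)) (.cell 1 (.reg 6) (.reg 4)))))
      (.sub (.sub (.sub (.const 1) (.reg 11)) (.sub (.const 1) (.sub (.reg 4) (.reg 5))))
        (.sub (.const 1) (.dist (.reg 5) (.reg 1)))))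

/-- The vertices that are kept are listed in array `3`. Register `8` becomes their number, and
register `12` the position of the root. -/
def Prog.select : Prog :=
  .seq (.assign 8 (.const 0)) (.forLoop 4
    (.seq .countTwins
      (.seq (.write 3 (.reg 8) (.const 0) (.reg 4))
        (.seq (.cond (.eq (.reg 4) (.reg 1)) (.assign 12 (.reg 8)) .skip)
          (.cond (.and (.not (.eq (.reg 4) (.reg 1))) (.not (.lt (.reg 10) (.reg 9))))
            .skip (.assign 8 (.add (.reg 8) (.const 1))))))))

theorem exec_countTwins (s : Store) :
    Exec .countTwins (s.reg 0 * 20 + (s.reg 0 * (s.reg 0 * 42 + 40) + 20)) s fun s' =>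
      Frame {5, 6, 9, 10, 11} ∅ s s' ∧
      s'.reg 9 = matrixDegree (s.reg 0) (s.arr 1) (s.reg 4) ∧
      s'.reg 10 = matrixTwins (s.reg 0) (s.arr 1) (s.reg 1) (s.reg 4) := by
  refine Exec.mono_time (Exec.seq (Exec.sumLoop (R := ∅) (A := ∅) (T := 1)
    (fun w => s.arr 1 (s.reg 4) w + s.arr 1 w (s.reg 4)) (by simp) (by simp) (by simp) (by simp)
    (by simp) (by simp) ?_) fun s₁ hs₁ => Exec.weaken (T' := s.reg 0 * (s.reg 0 * 42 + 40) + 7)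
      (Exec.sumLoop (r := 5) (acc := 10) (R := {6, 11}) (A := ∅)
      (T := s.reg 0 * 42 + 7)
      (fun u => ((1 - matrixDist (s.reg 0) (s.arr 1) u (s.reg 4)) - (1 - (s.reg 4 - u))) -
        (1 - ((u - s.reg 1) + (s.reg 1 - u)))) (by simp) (by simp) (by simp) (by simp) (by simp)
      (by simp) ?_) ?_ ?_) ?_
  · intro j hj s₁ hf h5
    refine Exec.skip ⟨Frame.refl _, ?_⟩
    simp only [Expr.eval, h5, hf.reg 4 (by simp), hf.arr 1 (by simp)]
  · intro u hu s₂ hf h5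
    have h0 : s₂.reg 0 = s.reg 0 := (hf.reg 0 (by simp)).trans (hs₁.1.reg 0 (by simp))
    have h1 : s₂.reg 1 = s.reg 1 := (hf.reg 1 (by simp)).trans (hs₁.1.reg 1 (by simp))
    have h4 : s₂.reg 4 = s.reg 4 := (hf.reg 4 (by simp)).trans (hs₁.1.reg 4 (by simp))
    have hM : s₂.arr 1 = s.arr 1 := (hf.arr 1 (by simp)).trans (hs₁.1.arr 1 (by simp))
    refine Exec.weaken (Exec.sumLoop (R := ∅) (A := ∅) (T := 1)
      (fun w => (((s.arr 1 u w - s.arr 1 (s.reg 4) w) + (s.arr 1 (s.reg 4) w - s.arr 1 u w)) +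
        ((s.arr 1 w u - s.arr 1 w (s.reg 4)) + (s.arr 1 w (s.reg 4) - s.arr 1 w u))))
      (by simp) (by simp) (by simp) (by simp) (by simp) (by simp) ?_) ?_ ?_
    · intro w hw s₃ hf₃ h6
      refine Exec.skip ⟨Frame.refl _, ?_⟩
      simp only [Expr.dist, Expr.eval, h6, hf₃.reg 5 (by simp), hf₃.reg 4 (by simp),
        hf₃.arr 1 (by simp), hM, h4, h5]
    · rw [h0]
      simp [Expr.dist, Expr.cost]
    · rintro s₃ ⟨hf₃, h11⟩
      refine ⟨by simpa using hf₃, ?_⟩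
      simp only [Expr.dist, Expr.eval, h11, hf₃.reg 5 (by simp), hf₃.reg 4 (by simp),
        hf₃.reg 1 (by simp), h0, h1, h4, h5]
      rfl
  · have h0 : s₁.reg 0 = s.reg 0 := hs₁.1.reg 0 (by simp)
    rw [h0]
    refine Nat.add_le_add_right (Nat.mul_le_mul_left _ ?_) _
    simp only [Expr.dist, Expr.cost]
    omega
  · rintro s₂ ⟨hf, h10⟩
    have h0 : s₁.reg 0 = s.reg 0 := hs₁.1.reg 0 (by simp)
    rw [h0] at h10
    refine ⟨?_, ?_, h10⟩
    · exact (hs₁.1.mono (by decide) subset_rfl).trans (hf.mono (by decide) subset_rfl)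
    · rw [hf.reg 9 (by simp), hs₁.2]
      rfl
  · simp only [Expr.cost]
    omega

/-- Every vertex is written at position `reg 8`, but the position advances only past kept ones, so
any other entry is overwritten or ends up beyond the list. A kept `u` thus gets position `Nat.count
_ u`. -/
theorem exec_select (s : Store) :
    Exec .select (s.reg 0 * (s.reg 0 * 20 + (s.reg 0 * (s.reg 0 * 42 + 40) + 60)) + 7) s fun s' =>
      Frame {4, 5, 6, 8, 9, 10, 11, 12} {3} s s' ∧
      s'.reg 8 = Nat.count (matrixKept (s.reg 0) (s.arr 1) (s.reg 1)) (s.reg 0) ∧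
      (∀ u < s.reg 0, matrixKept (s.reg 0) (s.arr 1) (s.reg 1) u →
        s'.arr 3 (Nat.count (matrixKept (s.reg 0) (s.arr 1) (s.reg 1)) u) 0 = u) ∧
      (s.reg 1 < s.reg 0 → s'.reg 12 =
        Nat.count (matrixKept (s.reg 0) (s.arr 1) (s.reg 1)) (s.reg 1)) := by
  set P := matrixKept (s.reg 0) (s.arr 1) (s.reg 1) with hP
  refine Exec.mono_time (Exec.seq (Exec.assign (Q := fun s' => s' = s.setReg 8 0) rfl)
    fun s₀ hs₀ => Exec.weaken
      (T' := s.reg 0 * (s.reg 0 * 20 + (s.reg 0 * (s.reg 0 * 42 + 40) + 60)) + 5)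
      (Exec.forLoop (r := 4) (R := {5, 6, 8, 9, 10, 11, 12}) (A := {3})
      (T := s.reg 0 * 20 + (s.reg 0 * (s.reg 0 * 42 + 40) + 50))
      (fun v s' => s'.reg 8 = Nat.count P v ∧
        (∀ u < v, P u → s'.arr 3 (Nat.count P u) 0 = u) ∧
        (s.reg 1 < v → s'.reg 12 = Nat.count P (s.reg 1))) (by simp) (by simp) (by simp) ?_ ?_) ?_ ?_)
    (by simp only [Expr.cost]; omega)
  · simp [hs₀]
  · rintro v hv s₁ hf h4 ⟨h8, h3, h12⟩
    have h0 : s₁.reg 0 = s.reg 0 := by rw [hf.reg 0 (by simp), hs₀]; rfl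
    have h1 : s₁.reg 1 = s.reg 1 := by rw [hf.reg 1 (by simp), hs₀]; rfl
    have hM : s₁.arr 1 = s.arr 1 := by rw [hf.arr 1 (by simp), hs₀]; rfl
    have hex := exec_countTwins s₁
    rw [h0, h1, hM, h4] at hex
    refine Exec.mono_time (Exec.seq hex fun s₂ hs₂ => Exec.seq
      (Exec.write (Q := fun s' => s' = s₂.setCell 3 (Nat.count P v) 0 v) ?_)
      fun s₃ hs₃ => Exec.seq
        (Exec.cond (T := 2) (Q := fun s' => s' =
          if v = s.reg 1 then s₃.setReg 12 (Nat.count P v) else s₃) ?_ ?_)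
        fun s₄ hs₄ => Exec.weaken (T' := 13) (Exec.cond (T := 4) (Q := fun s' => s' =
          if P v then s₄.setReg 8 (Nat.count P v + 1) else s₄) ?_ ?_) ?_ ?_) ?_
    · simp only [Expr.eval, hs₂.1.reg 8 (by simp), hs₂.1.reg 4 (by simp), h8, h4]
    · obtain ⟨hf₂, h9, h10⟩ := hs₂
      intro hb
      simp only [Test.Holds, Expr.eval, hs₃, Store.setCell_reg, hf₂.reg 4 (by simp),
        hf₂.reg 1 (by simp), h4, h1] at hb
      refine Exec.assign ?_
      rw [if_pos hb]
      simp only [Expr.eval, hs₃, Store.setCell_reg, hf₂.reg 8 (by simp), h8]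
    · obtain ⟨hf₂, h9, h10⟩ := hs₂
      intro hb
      simp only [Test.Holds, Expr.eval, hs₃, Store.setCell_reg, hf₂.reg 4 (by simp),
        hf₂.reg 1 (by simp), h4, h1] at hb
      refine Exec.weaken (Exec.skip ?_) (by norm_num) fun _ h => h
      rw [if_neg hb]
    all_goals try
      obtain ⟨hf₂, h9, h10⟩ := hs₂
      have hreg : ∀ i, i ≠ 12 → s₄.reg i = s₂.reg i := by
        intro i hi
        rw [hs₄]
        split_ifs
        · simp [hs₃, hi]
        · simp [hs₃]
    · intro hb
      simp only [Test.Holds, Expr.eval, hreg 4 (by simp), hreg 1 (by simp), hreg 9 (by simp),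
        hreg 10 (by simp), hf₂.reg 4 (by simp), hf₂.reg 1 (by simp), h4, h1, h9, h10] at hb
      refine Exec.weaken (Exec.skip ?_) (by norm_num) fun _ h => h
      rw [if_neg]
      rintro (h | h)
      exacts [hb.1 h, hb.2 h]
    · intro hb
      simp only [Test.Holds, Expr.eval, hreg 4 (by simp), hreg 1 (by simp), hreg 9 (by simp),
        hreg 10 (by simp), hf₂.reg 4 (by simp), hf₂.reg 1 (by simp), h4, h1, h9, h10] at hb
      refine Exec.assign ?_
      rw [if_pos]
      · simp only [Expr.eval, hreg 8 (by simp), hf₂.reg 8 (by simp), h8]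
      · by_contra hcon
        exact hb ⟨fun h => hcon (Or.inl h), fun h => hcon (Or.inr h)⟩
    · simp [Test.cost, Expr.cost]
    · intro s₅ hs₅
      have hreg₅ : ∀ i, i ≠ 8 → s₅.reg i = s₄.reg i := by
        intro i hi
        rw [hs₅]
        split_ifs <;> simp [hi]
      have harr : s₅.arr = s₃.arr := by
        rw [hs₅, hs₄]
        split_ifs <;> rfl
      have h8' : s₅.reg 8 = Nat.count P (v + 1) := by
        rw [Nat.count_succ, hs₅]
        split_ifs
        · simp
        · rw [hreg 8 (by simp), hf₂.reg 8 (by simp), h8, add_zero]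
      refine ⟨⟨?_, ?_⟩, ?_, ?_, ?_⟩
      · intro i hi
        simp only [Finset.mem_insert, Finset.mem_singleton, not_or] at hi
        rw [hreg₅ i (by tauto), hreg i (by tauto), hf₂.reg i (by simp; tauto)]
      · intro a ha
        rw [Finset.mem_singleton] at ha
        rw [harr, hs₃, ← hf₂.arr a (by simp)]
        funext i j
        simp [ha]
      · simp [h8']
      · intro u hu hPu
        rw [Store.setReg_arr, harr, hs₃, Store.setCell_arr]
        rcases Nat.lt_succ_iff_lt_or_eq.1 hu with h | rfl
        · have := Nat.count_strict_mono hPu h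
          rw [if_neg (by omega), hf₂.arr 3 (by simp)]
          exact h3 u h hPu
        · simp
      · intro hlt
        rw [Store.setReg_reg, if_neg (by simp), hreg₅ 12 (by simp), hs₄]
        split_ifs with h
        · simp [h]
        · rw [hs₃, Store.setCell_reg, hf₂.reg 12 (by simp)]
          exact h12 (by omega)
    · simp only [Test.cost, Expr.cost]
      omega
  · have h0 : s₀.reg 0 = s.reg 0 := by rw [hs₀]; rfl
    rw [h0]
    exact Nat.add_le_add_right (Nat.mul_le_mul_left _ (by omega)) _
  · rintro s' ⟨hf, h⟩
    have h0 : s₀.reg 0 = s.reg 0 := by rw [hs₀]; rfl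
    rw [h0] at h
    refine ⟨?_, h⟩
    rw [hs₀] at hf
    exact ((Frame.refl s).setReg (by simp) 0).trans (hf.mono (by decide) subset_rfl)

end Select

/-! ## The kernelization -/

/-! ### Adjacency matrices and the digraphs they encode. -/

section Matrix

variable {n : ℕ} {E : Fin n → Fin n → Prop} {M : ℕ → ℕ → ℕ} {r : Fin n}

open Classical in
/-- `M` is the adjacency matrix of `E`. -/
def IsAdjMatrix (E : Fin n → Fin n → Prop) (M : ℕ → ℕ → ℕ) : Prop :=
  ∀ u v : Fin n, M u v = if E u v then 1 else 0

theorem IsAdjMatrix.matrixDegree_eq (h : IsAdjMatrix E M) (v : Fin n) :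
    matrixDegree n M v = totalDegree E v := by
  classical
  rw [matrixDegree, Finset.sum_range, Finset.sum_add_distrib, totalDegree,
    Set.ncard_eq_toFinset_card', Set.ncard_eq_toFinset_card', Set.toFinset_ofPred,
    Set.toFinset_ofPred, Finset.card_filter, Finset.card_filter]
  simp only [h _ _]

theorem IsAdjMatrix.matrixDist_eq_zero_iff (h : IsAdjMatrix E M) (u v : Fin n) :
    matrixDist n M u v = 0 ↔ AreTwins E u v := by
  classical
  rw [matrixDist, Finset.sum_range, Finset.sum_eq_zero_iff]
  simp only [Finset.mem_univ, true_implies, h _ _, AreTwins]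
  refine forall_congr' fun w => ?_
  by_cases h1 : E u w <;> by_cases h2 : E v w <;> by_cases h3 : E w u <;> by_cases h4 : E w v <;>
    simp [h1, h2, h3, h4]

/-- Under truncated subtraction `1 - x` is the indicator of `x = 0`, so a summand is `1` if the
distance is `0` and neither `v ≤ u` nor `u = r`, and `0` otherwise. -/
theorem IsAdjMatrix.matrixTwins_eq (h : IsAdjMatrix E M) (v : Fin n) :
    matrixTwins n M r v = {u | u < v ∧ u ≠ r ∧ AreTwins E u v}.ncard := by
  classical
  rw [matrixTwins, Finset.sum_range, Set.ncard_eq_toFinset_card', Set.toFinset_ofPred,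
    Finset.card_filter]
  refine Finset.sum_congr rfl fun u _ => ?_
  have hiff : (u < v ∧ u ≠ r ∧ AreTwins E u v) ↔
      ((u : ℕ) < v ∧ (u : ℕ) ≠ r ∧ matrixDist n M u v = 0) := by
    rw [h.matrixDist_eq_zero_iff, Fin.lt_def, Ne, Fin.ext_iff]
  simp only [hiff]
  split_ifs with hc <;> omega

theorem IsAdjMatrix.matrixKept_iff (h : IsAdjMatrix E M) (v : Fin n) :
    matrixKept n M r v ↔ IsKept E r v := by
  rw [matrixKept, IsKept, h.matrixTwins_eq, h.matrixDegree_eq, Fin.ext_iff]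

theorem IsAdjMatrix.matrixAdj_iff (h : IsAdjMatrix E M) (u v : Fin n) :
    matrixAdj n M u v ↔ E u v := by
  rw [matrixAdj, h u v]
  split_ifs with h' <;> simp [h']

theorem IsAdjMatrix.reflTransGen_iff (h : IsAdjMatrix E M) (v : Fin n) :
    Relation.ReflTransGen (matrixAdj n M) r v ↔ Relation.ReflTransGen E r v := by
  constructor
  · intro hv
    have : ∀ w, Relation.ReflTransGen (matrixAdj n M) r w → ∀ v : Fin n, w = v →
        Relation.ReflTransGen E r v := by
      intro w hw
      induction hw with
      | refl =>
        intro v hv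
        rw [Fin.ext hv]
      | @tail b c _ hbc ih =>
        rintro v rfl
        exact (ih ⟨b, hbc.1⟩ rfl).tail ((h.matrixAdj_iff ⟨b, hbc.1⟩ v).1 hbc)
    exact this _ hv v rfl
  · exact fun hv => hv.lift (fun v : Fin n => (v : ℕ)) fun a b hab => (h.matrixAdj_iff a b).2 hab

end Matrix

/-- `Nat.count P` numbers the solutions of `P` consecutively, so no position of the output list is
left empty. -/
theorem exists_count_eq (P : ℕ → Prop) [DecidablePred P] (n : ℕ) :
    ∀ i < Nat.count P n, ∃ u < n, P u ∧ Nat.count P u = i := by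
  induction n with
  | zero => simp
  | succ n ih =>
    intro i hi
    by_cases h : i < Nat.count P n
    · obtain ⟨u, hu, hPu⟩ := ih i h
      exact ⟨u, hu.trans (Nat.lt_succ_self n), hPu⟩
    · rw [Nat.count_succ] at hi
      split_ifs at hi with hn
      · exact ⟨n, Nat.lt_succ_self n, hn, by omega⟩
      · omega

/-- The entry of the adjacency matrix in array `0` if it is off the diagonal, and `0` otherwise. -/
def offDiagonal : Expr :=
  .sub (.add (.cell 0 (.reg 4) (.reg 5))
    (.sub (.const 1) (.sub (.const 1) (.dist (.reg 4) (.reg 5))))) (.const 1)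

/-- The subgraph induced by the vertices listed in array `3` becomes the instance. -/
def Prog.outputInduced : Prog :=
  .seq (.fill 4 (.cell 0 (.cell 3 (.reg 4) (.const 0)) (.cell 3 (.reg 5) (.const 0))))
    (.seq (.fill 0 (.cell 4 (.reg 4) (.reg 5)))
      (.seq (.assign 3 (.const 2)) (.seq (.assign 1 (.reg 12)) (.assign 0 (.reg 8)))))

/-- The kernelization whose output has at most `c * k` vertices. -/
def Prog.kernelize (c : ℕ) : Prog :=
  .seq (.fill 1 offDiagonal) (.seq .markReachable
    (.seq (.sumLoop 4 7 .skip (.sub (.const 1) (.cell 2 (.reg 4) (.const 0))))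
      (.cond (.lt (.const 0) (.reg 7)) (.assign 3 (.const 0))
        (.seq .select (.cond (.lt (Expr.nsmul (.reg 2) c) (.reg 8)) (.assign 3 (.const 1))
          .outputInduced)))))

/-- The new matrix is assembled in array `4`, because writing directly into array `0` could destroy
entries still to be read. Register `0` changes only after the loops it bounds. -/
theorem exec_outputInduced (s : Store) :
    Exec .outputInduced (s.reg 0 * (s.reg 0 * 17 + 12) + (s.reg 0 * (s.reg 0 * 13 + 12) + 16)) s
      fun s' => s'.reg 0 = s.reg 8 ∧ s'.reg 1 = s.reg 12 ∧ s'.reg 2 = s.reg 2 ∧ s'.reg 3 = 2 ∧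
        ∀ i < s.reg 0, ∀ j < s.reg 0, s'.arr 0 i j = s.arr 0 (s.arr 3 i 0) (s.arr 3 j 0) := by
  refine Exec.mono_time (Exec.seq
    (Exec.fill (fun i j => s.arr 0 (s.arr 3 i 0) (s.arr 3 j 0)) ?_)
    fun s₁ hs₁ => Exec.mono_time (T' := s.reg 0 * (s.reg 0 * 13 + 12) + 11) (Exec.seq
      (Exec.fill (fun i j => s₁.arr 4 i j) ?_)
      fun s₂ hs₂ => Exec.seq (Exec.assign (Q := fun s' => s' = s₂.setReg 3 2) rfl)
        fun s₃ hs₃ => Exec.seq (Exec.assign (Q := fun s' => s' = s₃.setReg 1 (s₃.reg 12)) rfl)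
          fun s₄ hs₄ => Exec.assign ?_) ?_) ?_
  · intro i hi j hj s₁ hf h4 h5
    simp only [Expr.eval, h4, h5, hf.arr 0 (by simp), hf.arr 3 (by simp)]
  · intro i hi j hj s₂ hf h4 h5
    simp only [Expr.eval, h4, h5, hf.arr 4 (by simp)]
  · obtain ⟨hf₁, h₁⟩ := hs₁
    obtain ⟨hf₂, h₂⟩ := hs₂
    simp only [hs₄, hs₃, Expr.eval, Store.setReg_reg, Store.setReg_arr]
    refine ⟨?_, ?_, ?_, by simp, ?_⟩
    · simp [hf₂.reg 8 (by simp), hf₁.reg 8 (by simp)]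
    · simp [hf₂.reg 12 (by simp), hf₁.reg 12 (by simp)]
    · simp [hf₂.reg 2 (by simp), hf₁.reg 2 (by simp)]
    · intro i hi j hj
      rw [hf₁.reg 0 (by simp)] at h₂
      rw [h₂ i hi j hj, h₁ i hi j hj]
  · rw [hs₁.1.reg 0 (by simp)]
    simp [Expr.cost, add_assoc]
  · simp only [Expr.cost]
    norm_num
    omega

/-- The running time of `Prog.kernelize`. -/
noncomputable def kernelizeTime (c : ℕ) : Polynomial ℕ :=
  let n : Polynomial ℕ := .X
  n * (n * 27 + 12) + (n * (n * (n * 22 + 12) + 12) +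
    (n * 20 + (n * (n * 20 + (n * (n * 42 + 40) + 60))
    + (n * (n * 17 + 12) + (n * (n * 13 + 12) + .C (Expr.cost (.nsmul (.reg 2) c) + 50))))))

/-- The output instance. -/
theorem exists_holdsInstance (X : InternalOutBranching) {M : ℕ → ℕ → ℕ}
    (hM : IsAdjMatrix X.D.ProperAdj M) {s s' : Store} (hX : s.HoldsInstance X)
    (h0 : s'.reg 0 = Nat.count (matrixKept X.n M X.root) X.n)
    (h1 : s'.reg 1 = Nat.count (matrixKept X.n M X.root) X.root) (h2 : s'.reg 2 = X.k)
    {f : ℕ → ℕ} (hf : ∀ u < X.n, matrixKept X.n M X.root u →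
      f (Nat.count (matrixKept X.n M X.root) u) = u)
    (harr : ∀ i < X.n, ∀ j < X.n, s'.arr 0 i j = s.arr 0 (f i) (f j))
    (hreach : ∀ v, Relation.ReflTransGen X.D.ProperAdj X.root v) :
    ∃ Y : InternalOutBranching, s'.HoldsInstance Y ∧ Y.k = X.k ∧ (Y.IsYes ↔ X.IsYes) ∧
      Y.n = s'.reg 0 ∧ Y.IsInducedIn X := by
  set P := matrixKept X.n M X.root with hP
  have hroot : P X.root := Or.inl rfl
  have hsurj := exists_count_eq P X.n
  have hval : ∀ i < Nat.count P X.n, f i < X.n ∧ P (f i) ∧ Nat.count P (f i) = i := by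
    intro i hi
    obtain ⟨u, hu, hPu, rfl⟩ := hsurj i hi
    rw [hf u hu hPu]
    exact ⟨hu, hPu, rfl⟩
  -- Injective because `Nat.count P` is a left inverse.
  let g : Fin (Nat.count P X.n) ↪ Fin X.n :=
    ⟨fun i => ⟨f i, (hval i i.2).1⟩, fun i j hij => by
      rw [Fin.mk.injEq] at hij
      rw [Fin.ext_iff, ← (hval i i.2).2.2, ← (hval j j.2).2.2, hij]⟩
  let Y : InternalOutBranching :=
    { n := Nat.count P X.n
      D := ⟨fun i j => X.D.Adj (g i) (g j)⟩
      root := ⟨Nat.count P X.root, Nat.count_strict_mono hroot X.root.2⟩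
      k := X.k }
  have hgroot : g Y.root = X.root := Fin.ext (hf X.root X.root.2 hroot)
  refine ⟨Y, ⟨h0, h1, h2, ?_⟩, rfl, ?_, h0.symm, g, hgroot, fun _ _ => Iff.rfl⟩
  · intro i j
    have hle : Nat.count P X.n ≤ X.n := Nat.count_le P
    have h := hX.2.2.2 (g i) (g j)
    rw [harr i (i.2.trans_le hle) j (j.2.trans_le hle)]
    exact h
  · have hrange : Set.range g = {v | IsKept X.D.ProperAdj X.root v} := by
      ext v
      rw [Set.mem_ofPred_eq, ← hM.matrixKept_iff]
      constructor
      · rintro ⟨i, rfl⟩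
        exact (hval i i.2).2.1
      · exact fun hv => ⟨⟨Nat.count P v, Nat.count_strict_mono hv v.2⟩, Fin.ext (hf v v.2 hv)⟩
    rw [Y.isYes_iff (X := X) g hgroot fun _ _ => Iff.rfl, hrange, X.isYes_iff_univ]
    exact hasInternalOutBranchingOn_kept_iff hreach

theorem count_matrixKept {n : ℕ} {E : Fin n → Fin n → Prop} {M : ℕ → ℕ → ℕ} {r : Fin n}
    (h : IsAdjMatrix E M) : Nat.count (matrixKept n M r) n = {v | IsKept E r v}.ncard := by
  classical
  rw [Nat.count_eq_card_filter_range, Set.ncard_eq_toFinset_card', Set.toFinset_ofPred,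
    Finset.card_filter, Finset.card_filter, Finset.sum_range]
  simp only [h.matrixKept_iff]

/-- The kernelization is correct for all digraphs on which NO-instances have few kept vertices. -/
theorem exec_kernelize (c : ℕ) (X : InternalOutBranching)
    (hc : (∀ v, Relation.ReflTransGen X.D.ProperAdj X.root v) → ¬ X.IsYes →
      {v | IsKept X.D.ProperAdj X.root v}.ncard ≤ c * X.k) :
    Exec (.kernelize c) ((kernelizeTime c).eval X.n) (input X) fun s =>
      (s.verdict = 0 ∧ ¬ X.IsYes) ∨ (s.verdict = 1 ∧ X.IsYes) ∨
        (s.verdict = 2 ∧ ∃ Y : InternalOutBranching, s.HoldsInstance Y ∧ Y.k = X.k ∧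
          (Y.IsYes ↔ X.IsYes) ∧ Y.n ≤ c * X.k ∧ Y.IsInducedIn X) := by
  classical
  have hX := input_holdsInstance X
  have h2 : ∀ v, (input X).arr 2 v 0 = 0 := by simp [input]
  set s := input X with hs
  obtain ⟨hn, hr, hk, hadj⟩ := id hX
  refine Exec.mono_time (Exec.seq (Exec.fill
      -- Adding the indicator of `i ≠ j` and subtracting `1` clears the diagonal and preserves the
      -- other 0/1 entries.
      (fun i j => (s.arr 0 i j + (1 - (1 - ((i - j) + (j - i))))) - 1) ?_) fun s₁ hs₁ =>
    Exec.seq (T := X.n * (X.n * (X.n * 22 + 12) + 12) + 9)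
      (Q' := fun s' => Frame {4, 5, 6} {2} s₁ s' ∧ ∀ v, v ∈ s'.marked X.n ↔
        Relation.ReflTransGen (matrixAdj X.n (s₁.arr 1)) X.root v) ?_ fun s₂ hs₂ =>
      Exec.seq (T := X.n * 20 + 7)
        (Q' := fun s' => Frame {4, 7} ∅ s₂ s' ∧
          s'.reg 7 = ∑ v ∈ Finset.range X.n, (1 - s₂.arr 2 v 0)) ?_ fun s₃ hs₃ =>
        Exec.cond (T := X.n * (X.n * 20 + (X.n * (X.n * 42 + 40) + 60)) + 7 +
          ((Test.lt (.nsmul (.reg 2) c) (.reg 8)).cost +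
            (X.n * (X.n * 17 + 12) + (X.n * (X.n * 13 + 12) + 16)))) ?_ ?_) ?_
  · intro i hi j hj s₁ hf h4 h5
    simp only [offDiagonal, Expr.dist, Expr.eval, h4, h5, hf.arr 0 (by simp)]
  all_goals try obtain ⟨hf₁, h₁⟩ := hs₁
  · have h0 : s₁.reg 0 = X.n := (hf₁.reg 0 (by simp)).trans hn
    have h1 : s₁.reg 1 = X.root := (hf₁.reg 1 (by simp)).trans hr
    have hex := exec_markReachable s₁ (by rw [h0, h1]; exact X.root.2)
      (fun v => by rw [hf₁.arr 2 (by simp), h2])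
    rwa [h0, h1] at hex
  all_goals try obtain ⟨hf₂, h₂⟩ := hs₂
  · have h0 : s₂.reg 0 = X.n := (hf₂.reg 0 (by simp)).trans ((hf₁.reg 0 (by simp)).trans hn)
    have hex := Exec.sumLoop (r := 4) (acc := 7) (q := .skip) (T := 1) (s := s₂)
      (e := .sub (.const 1) (.cell 2 (.reg 4) (.const 0))) (R := ∅) (A := ∅)
      (fun v => 1 - s₂.arr 2 v 0) (by simp) (by simp) (by simp) (by simp) (by simp) (by simp)
      (fun v hv s' hf h4 => Exec.skip ⟨Frame.refl _, by
        simp only [Expr.eval, h4, hf.arr 2 (by simp)]⟩)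
    rw [h0] at hex
    refine hex.mono_time ?_
    simp only [Expr.cost]
    omega
  all_goals try obtain ⟨hf₃, h₃⟩ := hs₃
  all_goals try
    have hM : IsAdjMatrix X.D.ProperAdj (s₁.arr 1) := by
      intro u v
      rw [h₁ u (by rw [hn]; exact u.2) v (by rw [hn]; exact v.2)]
      by_cases huv : u = v
      · rw [if_neg (fun h => h.2 huv), huv]
        by_cases hv : X.D.Adj v v
        · simp [(hadj v v).1 hv]
        · simp [(hadj v v).2 hv]
      · have huv' : 1 - (1 - (((u : ℕ) - v) + (v - u))) = 1 := by
          have := Fin.val_ne_of_ne huv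
          omega
        rw [huv']
        by_cases hv : X.D.Adj u v
        · rw [(hadj u v).1 hv, if_pos ⟨hv, huv⟩]
        · rw [(hadj u v).2 hv, if_neg fun h => hv h.1]
    have hmarked : ∀ v : Fin X.n, 0 < s₂.arr 2 v 0 ↔
        Relation.ReflTransGen X.D.ProperAdj X.root v := by
      intro v
      rw [← hM.reflTransGen_iff, ← h₂, Store.mem_marked]
      simp
    -- Register `7` counts the unmarked vertices.
    have hreach : s₃.reg 7 = 0 ↔ ∀ v, Relation.ReflTransGen X.D.ProperAdj X.root v := by
      rw [h₃, Finset.sum_range, Finset.sum_eq_zero_iff]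
      simp only [Finset.mem_univ, true_implies, ← hmarked]
      exact forall_congr' fun v => by omega
  · intro hb
    simp only [Test.Holds, Expr.eval] at hb
    refine Exec.mono_time (Exec.assign (Or.inl ⟨by simp [Store.verdict, Expr.eval], ?_⟩)) ?_
    · rw [X.isYes_iff_univ]
      rintro ⟨T, hT, -⟩
      exact hb.ne' (hreach.2 fun v => Relation.ReflTransGen.mono (fun _ _ h => hT.sub h) _ _
        (hT.reach (Set.mem_univ v)))
    · simp only [Expr.cost]
      omega
  · intro hb
    simp only [Test.Holds, Expr.eval, not_lt, Nat.le_zero] at hb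
    rw [hreach] at hb
    have hreg : ∀ i, i ∉ ({4, 5, 6, 7} : Finset ℕ) → s₃.reg i = s.reg i := by
      intro i hi
      simp only [Finset.mem_insert, Finset.mem_singleton, not_or] at hi
      rw [hf₃.reg i (by simp; tauto), hf₂.reg i (by simp; tauto), hf₁.reg i (by simp; tauto)]
    have h0 : s₃.reg 0 = X.n := (hreg 0 (by simp)).trans hn
    have h1 : s₃.reg 1 = X.root := (hreg 1 (by simp)).trans hr
    have hM₃ : s₃.arr 1 = s₁.arr 1 := (hf₃.arr 1 (by simp)).trans (hf₂.arr 1 (by simp))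
    have hex := exec_select s₃
    rw [h0, h1, hM₃] at hex
    refine Exec.seq hex fun s₄ ⟨hf₄, h8, hlist, h12⟩ => ?_
    have h12 := h12 X.root.2
    have h0₄ : s₄.reg 0 = X.n := (hf₄.reg 0 (by simp)).trans h0
    have h2₄ : s₄.reg 2 = X.k := (hf₄.reg 2 (by simp)).trans ((hreg 2 (by simp)).trans hk)
    have harr₄ : s₄.arr 0 = s.arr 0 := (hf₄.arr 0 (by simp)).trans ((hf₃.arr 0 (by simp)).trans
      ((hf₂.arr 0 (by simp)).trans (hf₁.arr 0 (by simp))))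
    refine Exec.cond (fun hlt => ?_) fun hlt => ?_
    · simp only [Test.Holds, Expr.eval_nsmul, Expr.eval, h2₄, h8, count_matrixKept hM] at hlt
      refine Exec.mono_time (Exec.assign (Or.inr (Or.inl ⟨by simp [Store.verdict, Expr.eval], ?_⟩)))
        ?_
      · by_contra hno
        exact absurd (hc hb hno) (not_le.2 hlt)
      · simp only [Expr.cost]
        omega
    · simp only [Test.Holds, Expr.eval_nsmul, Expr.eval, h2₄, not_lt] at hlt
      have hex := exec_outputInduced s₄
      rw [h0₄] at hex
      refine hex.weaken le_rfl ?_
      rintro s₅ ⟨e0, e1, e2, e3, earr⟩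
      refine Or.inr (Or.inr ⟨e3, ?_⟩)
      rw [harr₄] at earr
      obtain ⟨Y, hY, hYk, hYes, hYn, hYX⟩ := exists_holdsInstance X hM hX (e0.trans h8)
        (e1.trans h12) (e2.trans h2₄) hlist earr hb
      exact ⟨Y, hY, hYk, hYes, by rw [hYn, e0]; exact hlt, hYX⟩
  · rw [hn]
    simp [kernelizeTime, offDiagonal, Expr.dist, Expr.cost, Test.cost]
    omega

end Ram

theorem theorem2 (𝒢 : GraphClass) (hereditary : 𝒢.Hereditary)
    (boundedExpansion : 𝒢.BoundedExpansion) :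
    ∃ (P : Ram.Prog) (time : Polynomial ℕ) (c : ℕ),
      ∀ X : InternalOutBranching, X.InClass 𝒢 →
        ∃ (t : ℕ) (s : Ram.Store), Ram.Runs P (Ram.input X) t s ∧ t ≤ time.eval X.n ∧
          ((s.verdict = 0 ∧ ¬ X.IsYes) ∨
           (s.verdict = 1 ∧ X.IsYes) ∨
           (s.verdict = 2 ∧ ∃ Y : InternalOutBranching,
              s.HoldsInstance Y ∧ Y.k = X.k ∧ (Y.IsYes ↔ X.IsYes) ∧
              Y.n ≤ c * X.k ∧ Y.IsInducedIn X)) := by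
  -- Depth one is enough, since the contracted branch sets are stars.
  obtain ⟨d, hd⟩ := boundedExpansion.exists_edge_bound 1
  -- The cover has at most `2k` vertices. Per cover vertex, `1` counts itself, `d` the contracted
  -- vertices, and the last summand, `2m * 4 ^ m` with `m = 2d + 1`, the remaining kept ones.
  let c := (1 + d + 2 * (2 * d + 1) * 4 ^ (2 * d + 1)) * 2
  refine ⟨.kernelize c, Ram.kernelizeTime c, c, fun X hX => ?_⟩
  refine Ram.exec_kernelize c X fun hreach hno => ?_
  rw [X.isYes_iff_univ] at hno
  exact card_kept_le (fun W _ H hH => hd X.n _ hX W H hH) hreach hno
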